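/- Let $(X,\mathfrak A,\mu)$ be a standard Borel probability space and $\mathfrak A=\mathfrak A_0\supset\mathfrak A_1\supset\mathfrak A_2\supset\cdots$ a decreasing sequence of $\sigma$-algebras, with associated measurable partitions $\xi_0,\xi_1,\dots$ ($\xi_0$ is the partition into points). Let $\mu_n^x$ be the conditional measure on the element $C_n(x)$ of $\xi_n$ that contains $x$. All notions are modulo null sets. Assume that the filtration is of *finite type*: for every $n$ almost all elements of $\xi_n$ are finite, and the probability vectors (up to order of coordinates) of their conditional measures form a finite collection. **Markov chains.** A (time-inhomogeneous) Markov chain $\Phi=(\Phi_n)_{n\ge 0}$ on $(X,\mu)$, with finite state sets $S_n$, *generates* the filtration if $\mathfrak A_n=\sigma(\Phi_m: m\ge n)$ modulo null sets for all $n\ge 0$. An *initial metric* is a metric $\rho$ on the compact space $\prod_n S_n$ that induces the product topology and is a pointwise limit of semimetrics each depending on finitely many coordinates. Put $\rho_0(x,y)=\rho(\Phi(x),\Phi(y))$ and $$\rho_{n+1}(x,y)=K_{\rho_n}(\mu_{n+1}^x,\mu_{n+1}^y),\qquad K_{r}(\alpha,\beta)=\inf_\psi\int r\,d\psi ,$$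 where $\psi$ runs over all couplings of $\alpha$ and $\beta$. **Standardness.** A chain $\Phi$ generating the filtration is *standard* if $\bigcap_n\mathfrak A_n$ is trivial and, for some initial metric $\rho$, $\lim_{n}\int_X\int_X\rho_n(x,y)\,d\mu(x)\,d\mu(y)=0$. The filtration is *standard* if it is generated by some standard Markov chain with finite state sets. **Special couplings.** A *special coupling* of the elements $C_n(x_1),C_n(x_2)$ of $\xi_n$ is a coupling $\psi$ of $\mu_n^{x_1}$ and $\mu_n^{x_2}$ which also preserves the tree structure given by the partitions $\xi_k$, $k\le n$: for all $k\le n$ and all elements $D_1\subset C_n(x_1)$, $D_2\subset C_n(x_2)$ of $\xi_k$, the marginals of $\psi|_{D_1\times D_2}$ are $\psi(D_1\times D_2)\,\mu^{D_1}$ and $\psi(D_1\times D_2)\,\mu^{D_2}$, where $\mu^{D_i}$ is the conditional measure on $D_i$. **Standardness criterion.** For every $f\in L^\infty(X,\mu)$ and every $\varepsilon>0$ there is $N$ such that for all $n>N$ $$(\mu\times\mu)\Big\{(x_1,x_2):\ \int|f(z_1)-f(z_2)|\,d\psi(z_1,z_2)<\varepsilon\ \text{ for some special coupling }\psi\text{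 of }C_n(x_1),C_n(x_2)\Big\}>1-\varepsilon .$$ **Theorem.** A finite type filtration is standard if and only if it satisfies the standardness criterion. Moreover, every Markov chain with finite state sets that generates the filtration is standard if and only if the filtration satisfies the criterion. -/

import Mathlib

open MeasureTheory ProbabilityTheory Filter Topology
open scoped ENNReal

noncomputable section

namespace MarkovFiltration

/-- A decreasing filtration `𝔄₀ ⊇ 𝔄₁ ⊇ 𝔄₂ ⊇ ⋯` of σ-algebras on `X`, where `𝔄₀` is the σ-algebra of
all measurable sets. -/
structure DecFiltration (X : Type*) [mX : MeasurableSpace X] where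
  alg : ℕ → MeasurableSpace X
  antitone_alg : Antitone alg
  alg_zero : alg 0 = mX

section Filtration

variable {X : Type*} [MeasurableSpace X] [StandardBorelSpace X]

/-- The canonical system of conditional measures (in the sense of Rokhlin) of the measurable
partition `ξ_n` determined by the σ-algebra `𝔄_n`: `condMeasure 𝔉 μ n x` is the conditional measure
on the element of `ξ_n` that contains `x`. It is determined for `μ`-almost every `x`. -/
def condMeasure (𝔉 : DecFiltration X) (μ : Measure X) [IsFiniteMeasure μ] (n : ℕ) (x : X) :
    Measure X :=
  condExpKernel μ (𝔉.alg n) x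

/-- The element of the partition `ξ_n` that contains `x`, for a filtration whose partitions have
(almost surely) finite elements: the set of the points that are charged by the conditional measure.
For almost every `x` it is a set of full conditional measure which contains `x`, and the elements of
two points of it coincide. -/
def block (𝔉 : DecFiltration X) (μ : Measure X) [IsFiniteMeasure μ] (n : ℕ) (x : X) : Set X :=
  {y | condMeasure 𝔉 μ n x {y} ≠ 0}

/-- Finite type: for every `n` almost every element `C` of `ξ_n` is finite, and the probability
vectors `(μ^C {y})_{y ∈ C}` (up to the order of the coordinates) of almost all elements of `ξ_n`
form a finite collection. -/
def IsFiniteType (𝔉 : DecFiltration X) (μ : Measure X) [IsFiniteMeasure μ] : Prop :=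
  ∀ n, ∃ P : Set (Multiset ℝ≥0∞), P.Finite ∧ ∀ᵐ x ∂μ, ∃ C : Finset X,
    (C : Set X) = block 𝔉 μ n x ∧ condMeasure 𝔉 μ n x (C : Set X)ᶜ = 0 ∧
      C.val.map (fun y => condMeasure 𝔉 μ n x {y}) ∈ P

/-- Ergodicity (zero-one law): the intersection of the σ-algebras is trivial. -/
def IsErgodic (𝔉 : DecFiltration X) (μ : Measure X) : Prop :=
  ∀ s, (∀ n, MeasurableSet[𝔉.alg n] s) → μ s = 0 ∨ μ s = 1

/-- `ψ` is a coupling of `α` and `β`: a measure on the product with these marginals. -/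
def IsCoupling (α β : Measure X) (ψ : Measure (X × X)) : Prop :=
  ψ.map Prod.fst = α ∧ ψ.map Prod.snd = β

/-- The Kantorovich distance of `α` and `β` with respect to the semimetric `r`. -/
def kantorovich (r : X → X → ℝ≥0∞) (α β : Measure X) : ℝ≥0∞ :=
  ⨅ (ψ : Measure (X × X)) (_ : IsCoupling α β ψ), ∫⁻ p, r p.1 p.2 ∂ψ

/-- The iterated transfer of a semimetric `r = ρ₀` along the filtration:
`ρ_{n+1}(x, y) = K_{ρ_n}(μ^x, μ^y)`, where `μ^x`, `μ^y` are the conditional measures on the elements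
of `ξ_{n+1}` that contain `x` and `y`. All `ρ_n` are regarded as semimetrics on `X`; as `ρ_n` is
constant on the elements of `ξ_n`, and couplings in `X/ξ_n` are exactly the images of couplings
in `X`, the infimum is the Kantorovich distance in `X/ξ_n`. -/
def iterSemimetric (𝔉 : DecFiltration X) (μ : Measure X) [IsFiniteMeasure μ]
    (r : X → X → ℝ≥0∞) : ℕ → X → X → ℝ≥0∞
  | 0 => r
  | n + 1 => fun x y =>
      kantorovich (iterSemimetric 𝔉 μ r n) (condMeasure 𝔉 μ (n + 1) x) (condMeasure 𝔉 μ (n + 1) y)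

end Filtration

/-- The space of all sequences `(a_n)` with `a_n` in a finite state set of `k n` elements, a compact
space with the product topology. -/
abbrev Path (k : ℕ → ℕ) : Type := ∀ n, Fin (k n)

/-- A cylinder semimetric: one that depends only on finitely many coordinates. -/
structure IsCylinderSemimetric {k : ℕ → ℕ} (r : Path k → Path k → ℝ) : Prop where
  nonneg : ∀ a b, 0 ≤ r a b
  self : ∀ a, r a a = 0
  symm : ∀ a b, r a b = r b a
  triangle : ∀ a b c, r a c ≤ r a b + r b c
  cylinder : ∃ n, ∀ a a' b b', (∀ i < n, a i = a' i) → (∀ i < n, b i = b' i) → r a b = r a' b'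

/-- An initial metric: a metric on the sequence space which agrees with the topology and is almost
cylinder, i.e. a limit of cylinder semimetrics. -/
structure IsInitialMetric {k : ℕ → ℕ} (ρ : Path k → Path k → ℝ) : Prop where
  eq_zero_iff : ∀ a b, ρ a b = 0 ↔ a = b
  symm : ∀ a b, ρ a b = ρ b a
  triangle : ∀ a b c, ρ a c ≤ ρ a b + ρ b c
  topology : ∀ a, (𝓝 a).HasBasis (fun ε : ℝ => 0 < ε) (fun ε => {b | ρ a b < ε})
  almostCylinder : ∃ r : ℕ → Path k → Path k → ℝ, (∀ i, IsCylinderSemimetric (r i)) ∧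
    ∀ a b, Tendsto (fun i => r i a b) atTop (𝓝 (ρ a b))

section Chain

variable {X : Type*} [MeasurableSpace X]

/-- The process `(Φ_n)` with finite state sets, given on `(X, μ)` by its trajectory map `Φ`, is a
Markov chain, in general inhomogeneous:
`P(Φ_{n+1} = a_{n+1} | Φ₀ = a₀, …, Φ_n = a_n) = P(Φ_{n+1} = a_{n+1} | Φ_n = a_n)`. -/
def IsMarkovChain {k : ℕ → ℕ} (μ : Measure X) (Φ : X → Path k) : Prop :=
  Measurable Φ ∧ ∀ (n : ℕ) (a : Path k),
    μ {x | ∀ i ≤ n + 1, Φ x i = a i} * μ {x | Φ x n = a n} =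
      μ {x | ∀ i ≤ n, Φ x i = a i} * μ {x | Φ x n = a n ∧ Φ x (n + 1) = a (n + 1)}

/-- The σ-algebra generated by the random variables `Φ_m`, `m ≥ n`. -/
abbrev tailAlg {X : Type*} {k : ℕ → ℕ} (Φ : X → Path k) (n : ℕ) : MeasurableSpace X :=
  ⨆ m ≥ n, MeasurableSpace.comap (fun x => Φ x m) inferInstance

/-- The filtration is the tail filtration of the Markov chain `Φ` with finite state sets, the
σ-algebras being taken modulo null sets. -/
def IsMarkovRealization (𝔉 : DecFiltration X) (μ : Measure X) {k : ℕ → ℕ} (Φ : X → Path k) :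
    Prop :=
  IsMarkovChain μ Φ ∧ ∀ n,
    (∀ s, MeasurableSet[𝔉.alg n] s → ∃ t, MeasurableSet[tailAlg Φ n] t ∧ s =ᵐ[μ] t) ∧
    (∀ t, MeasurableSet[tailAlg Φ n] t → ∃ s, MeasurableSet[𝔉.alg n] s ∧ t =ᵐ[μ] s)

variable [StandardBorelSpace X]

/-- Standardness of a Markov chain `Φ` that generates the filtration: the filtration is ergodic, and
for some initial metric `ρ` on the space of trajectories (which `Φ` identifies with `X` modulo null
sets) the iterated semimetrics `ρ_n` collapse in mean. -/
def IsStandardChain (𝔉 : DecFiltration X) (μ : Measure X) [IsFiniteMeasure μ] {k : ℕ → ℕ}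
    (Φ : X → Path k) : Prop :=
  IsErgodic 𝔉 μ ∧ ∃ ρ : Path k → Path k → ℝ, IsInitialMetric ρ ∧
    Tendsto (fun n => ∫⁻ p, iterSemimetric 𝔉 μ (fun x y => ENNReal.ofReal (ρ (Φ x) (Φ y))) n p.1 p.2
      ∂(μ.prod μ)) atTop (𝓝 0)

/-- A filtration is standard if it is the tail filtration of a standard Markov chain with finite
state sets. -/
def IsStandard (𝔉 : DecFiltration X) (μ : Measure X) [IsFiniteMeasure μ] : Prop :=
  ∃ (k : ℕ → ℕ) (Φ : X → Path k), IsMarkovRealization 𝔉 μ Φ ∧ IsStandardChain 𝔉 μ Φ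

end Chain

section Criterion

variable {X : Type*} [MeasurableSpace X] [StandardBorelSpace X]

/-- Special (Markov) couplings of the elements `C₁ ∋ x₁` and `C₂ ∋ x₂` of `ξ_n`, equipped with their
conditional measures and with the tree structure given by the partitions `ξ_k`, `k ≤ n`: couplings
`ψ` of the conditional measures such that for all vertices `D₁ ⊆ C₁`, `D₂ ⊆ C₂` of the two trees at
a common level `k`, the measure that `ψ` induces on `D₁ × D₂` is again a coupling of the conditional
measures of `D₁` and `D₂` (up to its total mass). -/
structure IsSpecialCoupling (𝔉 : DecFiltration X) (μ : Measure X) [IsFiniteMeasure μ] (n : ℕ)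
    (x₁ x₂ : X) (ψ : Measure (X × X)) : Prop where
  coupling : IsCoupling (condMeasure 𝔉 μ n x₁) (condMeasure 𝔉 μ n x₂) ψ
  tree : ∀ k ≤ n, ∀ z₁ ∈ block 𝔉 μ n x₁, ∀ z₂ ∈ block 𝔉 μ n x₂,
    IsCoupling (ψ (block 𝔉 μ k z₁ ×ˢ block 𝔉 μ k z₂) • condMeasure 𝔉 μ k z₁)
      (ψ (block 𝔉 μ k z₁ ×ˢ block 𝔉 μ k z₂) • condMeasure 𝔉 μ k z₂)
      (ψ.restrict (block 𝔉 μ k z₁ ×ˢ block 𝔉 μ k z₂))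

/-- The standardness criterion. -/
def StandardnessCriterion (𝔉 : DecFiltration X) (μ : Measure X) [IsFiniteMeasure μ] : Prop :=
  ∀ f : X → ℝ, MemLp f ∞ μ → ∀ ε : ℝ, 0 < ε → ∃ N : ℕ, ∀ n > N,
    1 - ε < (μ.prod μ).real {p | ∃ ψ, IsSpecialCoupling 𝔉 μ n p.1 p.2 ψ ∧
      ∫⁻ z, ENNReal.ofReal |f z.1 - f z.2| ∂ψ < ENNReal.ofReal ε}

end Criterion

end MarkovFiltration

end

/-! The iteration of Kantorovich distances is dynamic programming for transport between trees:
ρ_n(x, y) is the infimum of ∫ ρ_0 dψ over the special couplings ψ of C_n(x) and C_n(y). One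
inequality holds because a special coupling restricts to special couplings of the vertices below
(`iterSemimetric_le`), the other because special couplings of level n can be glued along a coupling
of level n + 1 (`exists_isSpecialCoupling`). So collapse of ρ_n and the criterion both say that most
pairs of blocks have a cheap special coupling; only the cost differs, ρ_0 in one case and |f(z₁) -
f(z₂)| in the other.

The costs are comparable. The ultrametric on trajectories is at most a difference |f - f|, where f
numbers the initial segments of length m, plus 2^{-m}; ergodicity follows from the criterion for
indicators. Conversely, f is close in L¹ to a function F of finitely many coordinates, and |F - F|
is at most a constant times ρ by compactness; the L¹ error is averaged over blocks and controlled by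
Markov's inequality. The Markov property plays no role here, so the equivalence holds for each
generating chain.

It remains to find one generating chain (`exists_isMarkovRealization`). The state of level n records
which sub-block of its block of level n + 1 contains x, and the conditional probabilities given 𝔄_n
of all events recorded before. Finite type leaves finitely many values. The recorded probabilities
give the Markov property, read backwards in time; Bayes' formula, with the recorded sub-block as the
condition, recovers 𝔄_n from the states of the levels from n on. -/

open MeasureTheory ProbabilityTheory Filter Topology
open scoped ENNReal

noncomputable section

namespace MarkovFiltration

/-! ### Countable generation of the σ-algebra. -/

section GeneratingSets

/-- A countable π-system of sets which generates the σ-algebra of a standard Borel space. -/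
def genSet (X : Type*) [MeasurableSpace X] [StandardBorelSpace X] (j : ℕ) : Set X :=
  embeddingReal X ⁻¹' Set.Iic ((Denumerable.ofNat ℚ j : ℚ) : ℝ)

variable {X : Type*} [mX : MeasurableSpace X] [StandardBorelSpace X]

lemma range_genSet :
    Set.range (genSet X) = Set.preimage (embeddingReal X) '' (⋃ a : ℚ, {Set.Iic (a : ℝ)}) := by
  ext s
  simp only [genSet, Set.mem_range, Set.mem_image, Set.mem_iUnion, Set.mem_singleton_iff]
  constructor
  · rintro ⟨j, rfl⟩
    exact ⟨_, ⟨_, rfl⟩, rfl⟩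
  · rintro ⟨_, ⟨q, rfl⟩, rfl⟩
    exact ⟨@Encodable.encode ℚ Denumerable.toEncodable q, by rw [Denumerable.ofNat_encode]⟩

lemma isPiSystem_range_genSet : IsPiSystem (Set.range (genSet X)) := by
  rw [range_genSet]
  rintro _ ⟨s, hs, rfl⟩ _ ⟨t, ht, rfl⟩ hst
  refine ⟨s ∩ t, Real.isPiSystem_Iic_rat s hs t ht ?_, rfl⟩
  rw [← Set.preimage_inter] at hst
  exact Set.nonempty_of_nonempty_preimage hst

lemma generateFrom_range_genSet : mX = MeasurableSpace.generateFrom (Set.range (genSet X)) := by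
  rw [range_genSet, ← MeasurableSpace.comap_generateFrom, ← Real.borel_eq_generateFrom_Iic_rat,
    ← BorelSpace.measurable_eq (α := ℝ)]
  exact (measurableEmbedding_embeddingReal X).comap_eq.symm

lemma measurableSet_genSet (j : ℕ) : MeasurableSet (genSet X j) :=
  measurable_embeddingReal X measurableSet_Iic

/-- Countably many tests suffice, so identities that hold almost surely for each fixed set become
almost sure identities of conditional measures. -/
lemma ext_of_genSet {α β : Measure X} [IsProbabilityMeasure α] [IsProbabilityMeasure β]
    (h : ∀ j, α (genSet X j) = β (genSet X j)) : α = β :=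
  ext_of_generate_finite _ generateFrom_range_genSet isPiSystem_range_genSet
    (by rintro _ ⟨j, rfl⟩; exact h j) (by simp)

end GeneratingSets

/-! ### Almost sure properties of conditional measures. -/

section CondMeasure

variable {X : Type*} [mX : MeasurableSpace X] [StandardBorelSpace X]
  (𝔉 : DecFiltration X) (μ : Measure X) [IsFiniteMeasure μ]

lemma DecFiltration.alg_le {X : Type*} [mX : MeasurableSpace X] (𝔉 : DecFiltration X) (n : ℕ) : 𝔉.alg n ≤ mX :=
  (𝔉.antitone_alg (Nat.zero_le n)).trans 𝔉.alg_zero.le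

instance (n : ℕ) (x : X) : IsProbabilityMeasure (condMeasure 𝔉 μ n x) := by
  unfold condMeasure; infer_instance

lemma measurable_condMeasure_apply (n : ℕ) {s : Set X} (hs : MeasurableSet s) :
    Measurable[𝔉.alg n] fun x => condMeasure 𝔉 μ n x s :=
  measurable_condExpKernel hs

lemma measurable_condMeasure (n : ℕ) : Measurable (condMeasure 𝔉 μ n) :=
  Measure.measurable_of_measurable_coe _ fun _ hs =>
    (measurable_condMeasure_apply 𝔉 μ n hs).mono (𝔉.alg_le n) le_rfl

lemma bind_condMeasure (n : ℕ) : μ.bind (condMeasure 𝔉 μ n) = μ := by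
  ext s hs
  rw [Measure.bind_apply hs (measurable_condMeasure 𝔉 μ n).aemeasurable]
  have h := congrArg (fun ν => ν s) (condExpKernel_comp_trim (μ := μ) (𝔉.alg_le n))
  rw [Measure.bind_apply hs (Kernel.aemeasurable _),
    lintegral_trim _ (measurable_condExpKernel hs)] at h
  exact h

lemma lintegral_condMeasure (n : ℕ) {f : X → ℝ≥0∞} (hf : Measurable f) :
    ∫⁻ x, ∫⁻ y, f y ∂condMeasure 𝔉 μ n x ∂μ = ∫⁻ x, f x ∂μ := by
  conv_rhs => rw [← bind_condMeasure 𝔉 μ n]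
  rw [Measure.lintegral_bind (measurable_condMeasure 𝔉 μ n).aemeasurable hf.aemeasurable]

variable {μ} in
lemma ae_condMeasure_ae (n : ℕ) {p : X → Prop} (h : ∀ᵐ x ∂μ, p x) :
    ∀ᵐ x ∂μ, ∀ᵐ y ∂condMeasure 𝔉 μ n x, p y := by
  obtain ⟨t, ht, htm, h0⟩ := exists_measurable_superset_of_null (ae_iff.1 h)
  have := lintegral_condMeasure 𝔉 μ n (measurable_one.indicator htm)
  rw [lintegral_indicator_one htm, h0, lintegral_eq_zero_iff] at this
  · filter_upwards [this] with x hx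
    rw [lintegral_indicator_one htm] at hx
    exact measure_mono_null ht hx
  · simp_rw [lintegral_indicator_one htm]
    exact (measurable_condMeasure_apply 𝔉 μ n htm).mono (𝔉.alg_le n) le_rfl

lemma setLIntegral_condMeasure (n : ℕ) {B s : Set X} (hB : MeasurableSet[𝔉.alg n] B)
    (hs : MeasurableSet s) : ∫⁻ x in B, condMeasure 𝔉 μ n x s ∂μ = μ (B ∩ s) := by
  have h := congrArg (fun ν => ν (B ×ˢ s)) (compProd_trim_condExpKernel (μ := μ) (𝔉.alg_le n))
  rw [Measure.compProd_apply_prod hB hs, restrict_trim (𝔉.alg_le n) μ hB,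
    lintegral_trim _ (measurable_condExpKernel hs), Measure.map_apply _ (hB.prod hs)] at h
  · exact h
  · exact Measurable.prodMk (measurable_id'' (𝔉.alg_le n)) measurable_id

/-- Integrating the conditional probability of t over the complement of t gives μ(∅) = 0. This is
applied to s and to its complement. -/
lemma ae_condMeasure_apply_of_measurableSet (n : ℕ) {s : Set X} (hs : MeasurableSet[𝔉.alg n] s) :
    ∀ᵐ x ∂μ, condMeasure 𝔉 μ n x s = s.indicator 1 x := by
  have key : ∀ t, MeasurableSet[𝔉.alg n] t → ∀ᵐ x ∂μ, x ∉ t → condMeasure 𝔉 μ n x t = 0 := by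
    intro t ht
    have htm := 𝔉.alg_le n _ ht
    have := setLIntegral_condMeasure 𝔉 μ n ht.compl htm
    rw [Set.compl_inter_self, measure_empty, lintegral_eq_zero_iff] at this
    · exact (ae_restrict_iff' htm.compl).1 this
    · exact (measurable_condMeasure_apply 𝔉 μ n htm).mono (𝔉.alg_le n) le_rfl
  filter_upwards [key s hs, key _ hs.compl] with x h1 h2
  by_cases hx : x ∈ s
  · rw [Set.indicator_of_mem hx, Pi.one_apply]
    exact (prob_compl_eq_zero_iff (𝔉.alg_le n _ hs)).1 (h2 (by simpa using hx))
  · rw [Set.indicator_of_notMem hx, h1 hx]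

lemma ae_condMeasure_ae_eq (n : ℕ) {g : X → ℝ} (hg : Measurable[𝔉.alg n] g) :
    ∀ᵐ x ∂μ, ∀ᵐ y ∂condMeasure 𝔉 μ n x, g y = g x := by
  have h : ∀ᵐ x ∂μ, ∀ q : ℚ,
      condMeasure 𝔉 μ n x {y | g y < q} = {y | g y < q}.indicator 1 x :=
    ae_all_iff.2 fun q => ae_condMeasure_apply_of_measurableSet 𝔉 μ n (hg measurableSet_Iio)
  filter_upwards [h] with x hx
  have h' : ∀ᵐ y ∂condMeasure 𝔉 μ n x, ∀ q : ℚ, g y < q ↔ g x < q := by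
    refine ae_all_iff.2 fun q => ?_
    have hm : MeasurableSet {y | g y < q} := 𝔉.alg_le n _ (hg measurableSet_Iio)
    by_cases hq : g x < q
    · have := hx q
      rw [Set.indicator_of_mem (by exact hq), Pi.one_apply, ← prob_compl_eq_zero_iff hm] at this
      simpa [ae_iff, hq, Set.compl_def] using this
    · have := hx q
      rw [Set.indicator_of_notMem (by exact hq)] at this
      simpa [ae_iff, hq] using this
  filter_upwards [h'] with y hy
  refine le_antisymm (le_of_not_gt fun hlt => ?_) (le_of_not_gt fun hlt => ?_)
  · obtain ⟨q, h1, h2⟩ := exists_rat_btwn hlt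
    exact absurd ((hy q).2 h1) h2.le.not_gt
  · obtain ⟨q, h1, h2⟩ := exists_rat_btwn hlt
    exact absurd ((hy q).1 h1) h2.le.not_gt

/-- A real function which encodes the conditional measure `condMeasure 𝔉 μ n x`. -/
def condCode (n : ℕ) (x : X) : ℝ :=
  embeddingReal (ℕ → ℝ) fun j => (condMeasure 𝔉 μ n x).real (genSet X j)

lemma measurable_condCode (n : ℕ) : Measurable[𝔉.alg n] (condCode 𝔉 μ n) := by
  refine (measurable_embeddingReal (ℕ → ℝ)).comp ?_
  exact @measurable_pi_lambda _ _ _ (𝔉.alg n) _ _ fun j =>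
    (measurable_condMeasure_apply 𝔉 μ n (measurableSet_genSet j)).ennreal_toReal

lemma condCode_eq_iff (n : ℕ) (x y : X) :
    condCode 𝔉 μ n x = condCode 𝔉 μ n y ↔ condMeasure 𝔉 μ n x = condMeasure 𝔉 μ n y := by
  refine ⟨fun h => ?_, fun h => by simp [condCode, h]⟩
  have := (measurableEmbedding_embeddingReal (ℕ → ℝ)).injective h
  exact ext_of_genSet fun j => (measureReal_eq_measureReal_iff (by finiteness) (by finiteness)).1 (congrFun this j)

lemma ae_condMeasure_eq (n : ℕ) :
    ∀ᵐ x ∂μ, ∀ᵐ y ∂condMeasure 𝔉 μ n x, condMeasure 𝔉 μ n y = condMeasure 𝔉 μ n x := by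
  filter_upwards [ae_condMeasure_ae_eq 𝔉 μ n (measurable_condCode 𝔉 μ n)] with x hx
  filter_upwards [hx] with y hy using (condCode_eq_iff 𝔉 μ n y x).1 hy

lemma ae_condMeasure_zero : ∀ᵐ x ∂μ, condMeasure 𝔉 μ 0 x = Measure.dirac x := by
  have h : ∀ᵐ x ∂μ, ∀ j, condMeasure 𝔉 μ 0 x (genSet X j) = (genSet X j).indicator 1 x :=
    ae_all_iff.2 fun j => ae_condMeasure_apply_of_measurableSet 𝔉 μ 0
      (by rw [𝔉.alg_zero]; exact measurableSet_genSet j)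
  filter_upwards [h] with x hx
  refine ext_of_genSet fun j => ?_
  rw [hx, Measure.dirac_apply' _ (measurableSet_genSet j)]

/-- The tower property of conditional expectation, tested on the generating sets. -/
lemma ae_bind_condMeasure (n : ℕ) :
    ∀ᵐ x ∂μ, (condMeasure 𝔉 μ (n + 1) x).bind (condMeasure 𝔉 μ n) = condMeasure 𝔉 μ (n + 1) x := by
  have key : ∀ s, MeasurableSet s → ∀ᵐ x ∂μ, ∫ z, (condMeasure 𝔉 μ n z).real s
      ∂condMeasure 𝔉 μ (n + 1) x = (condMeasure 𝔉 μ (n + 1) x).real s := by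
    intro s hs
    have h1 := condExp_ae_eq_integral_condExpKernel (μ := μ) (𝔉.alg_le (n + 1))
      (integrable_toReal_condExpKernel (μ := μ) (m := 𝔉.alg n) hs)
    have h2 := condExpKernel_ae_eq_condExp (μ := μ) (𝔉.alg_le n) hs
    have h3 := condExpKernel_ae_eq_condExp (μ := μ) (𝔉.alg_le (n + 1)) hs
    have h4 := condExp_condExp_of_le (f := s.indicator fun _ => (1 : ℝ)) (μ := μ)
      (𝔉.antitone_alg (Nat.le_succ n)) (𝔉.alg_le n)
    have h5 := condExp_congr_ae (m := 𝔉.alg (n + 1)) h2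
    filter_upwards [h1, h3, h4, h5] with x g1 g3 g4 g5
    change ∫ z, (condExpKernel μ (𝔉.alg n) z).real s ∂condExpKernel μ (𝔉.alg (n + 1)) x =
      (condExpKernel μ (𝔉.alg (n + 1)) x).real s
    rw [← g1, g5, g3]
    exact g4
  filter_upwards [ae_all_iff.2 fun j => key (genSet X j) (measurableSet_genSet j)] with x hx
  have hm := measurable_condMeasure 𝔉 μ n
  have : IsProbabilityMeasure ((condMeasure 𝔉 μ (n + 1) x).bind (condMeasure 𝔉 μ n)) :=
    ⟨by rw [Measure.bind_apply .univ hm.aemeasurable]; simp⟩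
  refine ext_of_genSet fun j => ?_
  have hs := measurableSet_genSet (X := X) j
  rw [Measure.bind_apply hs hm.aemeasurable, ← ENNReal.ofReal_toReal (measure_ne_top _ _),
    ← measureReal_def, ← hx j, ofReal_integral_eq_lintegral_ofReal]
  · simp
  · refine Integrable.of_bound (C := 1) ?_ (ae_of_all _ fun z => by
      rw [Real.norm_of_nonneg measureReal_nonneg]; exact measureReal_le_one)
    exact (((Measure.measurable_coe hs).comp hm).ennreal_toReal).aestronglyMeasurable
  · exact ae_of_all _ fun z => measureReal_nonneg

end CondMeasure

/-! ### A full-measure union of blocks without exceptional points. -/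

section RegularSet

variable {X : Type*} [MeasurableSpace X] [StandardBorelSpace X]

/-- A set of points on which the conditional measures of a filtration with finite blocks have all
their almost sure properties, and which is a union of blocks. -/
structure IsRegularSet (𝔉 : DecFiltration X) (μ : Measure X) [IsFiniteMeasure μ] (G : Set X) :
    Prop where
  finite : ∀ x ∈ G, ∀ n, (block 𝔉 μ n x).Finite
  compl_block : ∀ x ∈ G, ∀ n, condMeasure 𝔉 μ n x (block 𝔉 μ n x)ᶜ = 0
  mem_block : ∀ x ∈ G, ∀ n, x ∈ block 𝔉 μ n x
  block_subset : ∀ x ∈ G, ∀ n, block 𝔉 μ n x ⊆ G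
  condMeasure_eq : ∀ x ∈ G, ∀ n, ∀ y ∈ block 𝔉 μ n x, condMeasure 𝔉 μ n y = condMeasure 𝔉 μ n x
  bind_eq : ∀ x ∈ G, ∀ n,
    (condMeasure 𝔉 μ (n + 1) x).bind (condMeasure 𝔉 μ n) = condMeasure 𝔉 μ (n + 1) x
  zero_eq : ∀ x ∈ G, condMeasure 𝔉 μ 0 x = Measure.dirac x

variable {𝔉 : DecFiltration X} {μ : Measure X} [IsFiniteMeasure μ]

lemma forall_mem_block_of_ae {n : ℕ} {x : X} {p : X → Prop}
    (h : ∀ᵐ y ∂condMeasure 𝔉 μ n x, p y) : ∀ y ∈ block 𝔉 μ n x, p y := by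
  intro y hy
  by_contra hp
  exact hy (measure_mono_null (Set.singleton_subset_iff.2 hp) h)

/-- `Q k` asks for p after k successive passages from a point to almost every point of one of its
conditional measures. Points of a block are atoms, so none of them is exceptional, and the
intersection of all `Q k` is closed under taking blocks. -/
lemma exists_forall_block_subset {p : X → Prop} (hp : ∀ᵐ x ∂μ, p x) :
    ∃ G : Set X, (∀ᵐ x ∂μ, x ∈ G) ∧ (∀ x ∈ G, p x) ∧ ∀ x ∈ G, ∀ n, block 𝔉 μ n x ⊆ G := by
  let Q : ℕ → X → Prop := fun k => Nat.rec p
    (fun _ q x => ∀ n, ∀ᵐ y ∂condMeasure 𝔉 μ n x, q y) k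
  have hQ : ∀ k, ∀ᵐ x ∂μ, Q k x := by
    intro k
    induction k with
    | zero => exact hp
    | succ k ih => exact ae_all_iff.2 fun n => ae_condMeasure_ae 𝔉 n ih
  exact ⟨{x | ∀ k, Q k x}, ae_all_iff.2 hQ, fun x hx => hx 0,
    fun x hx n y hy k => forall_mem_block_of_ae (hx (k + 1) n) y hy⟩

lemma measurable_condMeasure_singleton (n : ℕ) :
    Measurable fun x => condMeasure 𝔉 μ n x {x} := by
  let κ : Kernel X X := ⟨condMeasure 𝔉 μ n, measurable_condMeasure 𝔉 μ n⟩
  have : IsMarkovKernel κ := ⟨fun x => inferInstanceAs (IsProbabilityMeasure (condMeasure 𝔉 μ n x))⟩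
  have he := measurable_embeddingReal X
  have ht : MeasurableSet {q : X × X | embeddingReal X q.2 = embeddingReal X q.1} :=
    measurableSet_eq_fun (he.comp measurable_snd) (he.comp measurable_fst)
  convert! Kernel.measurable_kernel_prodMk_left (κ := κ) ht using 3 with x
  ext y
  simp [(measurableEmbedding_embeddingReal X).injective.eq_iff]

lemma IsFiniteType.ae_finite (h : IsFiniteType 𝔉 μ) (n : ℕ) :
    ∀ᵐ x ∂μ, (block 𝔉 μ n x).Finite ∧ condMeasure 𝔉 μ n x (block 𝔉 μ n x)ᶜ = 0 := by
  obtain ⟨P, -, hP⟩ := h n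
  filter_upwards [hP] with x ⟨C, hC, h0, _⟩
  rw [← hC]
  exact ⟨C.finite_toSet, h0⟩

/-- A conditional measure lives on its block and is almost surely the conditional measure of the
points there. Hence it does not charge the points that lie outside their own block, and integration
shows that these are μ-null. -/
lemma IsFiniteType.ae_mem_block (h : IsFiniteType 𝔉 μ) (n : ℕ) :
    ∀ᵐ x ∂μ, x ∈ block 𝔉 μ n x := by
  have hN : MeasurableSet {x | condMeasure 𝔉 μ n x {x} = 0} :=
    measurable_condMeasure_singleton n (measurableSet_singleton 0)
  have : ∫⁻ x, condMeasure 𝔉 μ n x {x | condMeasure 𝔉 μ n x {x} = 0} ∂μ = 0 := by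
    refine (lintegral_congr_ae (g := 0) ?_).trans (by simp)
    filter_upwards [h.ae_finite n, ae_condMeasure_eq 𝔉 μ n] with x ⟨_, hx⟩ hx'
    refine measure_mono_null (t := _ ∪ _) (fun y hy => ?_) (measure_union_null hx hx')
    by_contra hc
    simp only [Set.mem_union, Set.mem_compl_iff, Set.mem_ofPred_eq, not_or, not_not] at hc hy
    rw [hc.2] at hy
    exact hc.1 hy
  have h2 := congrArg (fun ν => ν {x | condMeasure 𝔉 μ n x {x} = 0}) (bind_condMeasure 𝔉 μ n)
  simp only [Measure.bind_apply hN (measurable_condMeasure 𝔉 μ n).aemeasurable, this] at h2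
  simpa [ae_iff, block] using h2.symm

lemma IsFiniteType.exists_isRegularSet (h : IsFiniteType 𝔉 μ) {p : X → Prop}
    (hp : ∀ᵐ x ∂μ, p x) :
    ∃ G : Set X, IsRegularSet 𝔉 μ G ∧ (∀ᵐ x ∂μ, x ∈ G) ∧ ∀ x ∈ G, p x := by
  have hall : ∀ᵐ x ∂μ, p x ∧ (∀ n, (block 𝔉 μ n x).Finite ∧
      condMeasure 𝔉 μ n x (block 𝔉 μ n x)ᶜ = 0) ∧ (∀ n, x ∈ block 𝔉 μ n x) ∧
      (∀ n, ∀ᵐ y ∂condMeasure 𝔉 μ n x, condMeasure 𝔉 μ n y = condMeasure 𝔉 μ n x) ∧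
      (∀ n, (condMeasure 𝔉 μ (n + 1) x).bind (condMeasure 𝔉 μ n) = condMeasure 𝔉 μ (n + 1) x) ∧
      condMeasure 𝔉 μ 0 x = Measure.dirac x := by
    filter_upwards [hp, ae_all_iff.2 h.ae_finite, ae_all_iff.2 h.ae_mem_block,
      ae_all_iff.2 (ae_condMeasure_eq 𝔉 μ), ae_all_iff.2 (ae_bind_condMeasure 𝔉 μ),
      ae_condMeasure_zero 𝔉 μ] with x h1 h2 h3 h4 h5 h6
    exact ⟨h1, h2, h3, h4, h5, h6⟩
  obtain ⟨G, hG, hp, hb⟩ := exists_forall_block_subset (𝔉 := 𝔉) hall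
  exact ⟨G, ⟨fun x hx n => ((hp x hx).2.1 n).1, fun x hx n => ((hp x hx).2.1 n).2,
    fun x hx => (hp x hx).2.2.1, hb,
    fun x hx n => forall_mem_block_of_ae ((hp x hx).2.2.2.1 n),
    fun x hx => (hp x hx).2.2.2.2.1, fun x hx => (hp x hx).2.2.2.2.2⟩, hG, fun x hx => (hp x hx).1⟩

/-- No measurability of f is needed, which matters because the iterated semimetrics are not known to
be measurable. -/
lemma lintegral_eq_sum_of_compl_null {α : Type*} [MeasurableSpace α] [MeasurableSingletonClass α]
    {ν : Measure α} {s : Finset α} (hs : ν (s : Set α)ᶜ = 0) (f : α → ℝ≥0∞) :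
    ∫⁻ a, f a ∂ν = ∑ a ∈ s, f a * ν {a} := by
  rw [← lintegral_finset, Measure.restrict_eq_self_of_ae_mem]
  simpa [ae_iff, Set.compl_def] using hs

namespace IsRegularSet

variable {G : Set X} (hG : IsRegularSet 𝔉 μ G) {x y : X} {n : ℕ}
include hG

lemma block_eq (hx : x ∈ G) (hy : y ∈ block 𝔉 μ n x) : block 𝔉 μ n y = block 𝔉 μ n x := by
  simp only [block, hG.condMeasure_eq x hx n y hy]

/-- If y had no mass at level n + 1, then by the tower property μ_n^z would not charge y for every
atom z of μ_{n+1}^x, in particular for z = x. -/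
lemma block_subset_succ (hx : x ∈ G) : block 𝔉 μ n x ⊆ block 𝔉 μ (n + 1) x := by
  intro y hy h0
  have hm := measurable_condMeasure 𝔉 μ n
  have hm' : Measurable fun z => condMeasure 𝔉 μ n z {y} :=
    (Measure.measurable_coe (measurableSet_singleton y)).comp hm
  rw [← hG.bind_eq x hx n, Measure.bind_apply (measurableSet_singleton y) hm.aemeasurable,
    lintegral_eq_zero_iff hm'] at h0
  exact hy (forall_mem_block_of_ae h0 x (hG.mem_block x hx _))

lemma block_mono (hx : x ∈ G) {k : ℕ} (hk : k ≤ n) : block 𝔉 μ k x ⊆ block 𝔉 μ n x := by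
  induction n, hk using Nat.le_induction with
  | base => exact le_rfl
  | succ m _ ih => exact ih.trans (hG.block_subset_succ hx)

lemma block_zero (hx : x ∈ G) : block 𝔉 μ 0 x = {x} := by
  ext y
  simp [block, hG.zero_eq x hx]

lemma measurableSet_block (hx : x ∈ G) : MeasurableSet (block 𝔉 μ n x) :=
  (hG.finite x hx n).measurableSet

end IsRegularSet

end RegularSet

/-! ### Couplings and their marginals. -/

section Coupling

variable {X : Type*} [MeasurableSpace X]

lemma isCoupling_iff {α β : Measure X} {ψ : Measure (X × X)} :
    IsCoupling α β ψ ↔ ∀ s, MeasurableSet s →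
      ψ (Prod.fst ⁻¹' s) = α s ∧ ψ (Prod.snd ⁻¹' s) = β s := by
  refine ⟨fun h s hs => ⟨?_, ?_⟩, fun h => ⟨?_, ?_⟩⟩
  · rw [← h.1, Measure.map_apply measurable_fst hs]
  · rw [← h.2, Measure.map_apply measurable_snd hs]
  · ext s hs
    rw [Measure.map_apply measurable_fst hs, (h s hs).1]
  · ext s hs
    rw [Measure.map_apply measurable_snd hs, (h s hs).2]

lemma IsCoupling.lintegral_fst {α β : Measure X} {ψ : Measure (X × X)} (h : IsCoupling α β ψ)
    {f : X → ℝ≥0∞} (hf : Measurable f) : ∫⁻ z, f z.1 ∂ψ = ∫⁻ z, f z ∂α := by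
  rw [← h.1, lintegral_map hf measurable_fst]

lemma IsCoupling.lintegral_snd {α β : Measure X} {ψ : Measure (X × X)} (h : IsCoupling α β ψ)
    {f : X → ℝ≥0∞} (hf : Measurable f) : ∫⁻ z, f z.2 ∂ψ = ∫⁻ z, f z ∂β := by
  rw [← h.2, lintegral_map hf measurable_snd]

lemma IsCoupling.compl_prod_eq_zero {α β : Measure X} {ψ : Measure (X × X)} (h : IsCoupling α β ψ)
    {s t : Set X} (hs : MeasurableSet s) (ht : MeasurableSet t) (hα : α sᶜ = 0) (hβ : β tᶜ = 0) :
    ψ (s ×ˢ t)ᶜ = 0 := by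
  rw [isCoupling_iff] at h
  rw [Set.compl_prod_eq_union]
  refine measure_union_null ?_ ?_
  · rw [Set.prod_univ, (h _ hs.compl).1, hα]
  · rw [Set.univ_prod, (h _ ht.compl).2, hβ]

lemma IsCoupling.isProbabilityMeasure {α β : Measure X} [IsProbabilityMeasure α]
    {ψ : Measure (X × X)} (h : IsCoupling α β ψ) : IsProbabilityMeasure ψ :=
  ⟨by rw [← Set.preimage_univ (f := Prod.fst), (isCoupling_iff.1 h _ .univ).1, measure_univ]⟩

lemma IsCoupling.smul {α β : Measure X} {ψ : Measure (X × X)} (h : IsCoupling α β ψ) (c : ℝ≥0∞) :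
    IsCoupling (c • α) (c • β) (c • ψ) := by
  rw [IsCoupling, Measure.map_smul, Measure.map_smul, h.1, h.2]
  exact ⟨rfl, rfl⟩

lemma IsCoupling.sum {ι : Type*} {S : Finset ι} {α β : ι → Measure X}
    {ψ : ι → Measure (X × X)} (h : ∀ i ∈ S, IsCoupling (α i) (β i) (ψ i)) :
    IsCoupling (∑ i ∈ S, α i) (∑ i ∈ S, β i) (∑ i ∈ S, ψ i) := by
  refine isCoupling_iff.2 fun s hs => ?_
  simp only [Measure.finsetSum_apply]
  exact ⟨Finset.sum_congr rfl fun i hi => (isCoupling_iff.1 (h i hi) s hs).1,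
    Finset.sum_congr rfl fun i hi => (isCoupling_iff.1 (h i hi) s hs).2⟩

lemma isCoupling_zero {α β : Measure X} {ψ : Measure (X × X)} {D : Set (X × X)} (h : ψ D = 0) :
    IsCoupling (ψ D • α) (ψ D • β) (ψ.restrict D) := by
  rw [h, Measure.restrict_eq_zero.2 h, zero_smul, zero_smul]
  exact ⟨Measure.map_zero _, Measure.map_zero _⟩

lemma restrict_finset_sum {Y ι : Type*} [MeasurableSpace Y] (S : Finset ι) (ψ : ι → Measure Y)
    (D : Set Y) : (∑ i ∈ S, ψ i).restrict D = ∑ i ∈ S, (ψ i).restrict D := by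
  ext s hs
  simp [Measure.restrict_apply hs]

end Coupling

/-! ### Iterated semimetrics as optimal costs of special couplings. -/

section SpecialCoupling

variable {X : Type*} [MeasurableSpace X] [StandardBorelSpace X]
  {𝔉 : DecFiltration X} {μ : Measure X} [IsFiniteMeasure μ]

namespace IsRegularSet

variable {G : Set X} (hG : IsRegularSet 𝔉 μ G) {x y : X} {n : ℕ}
include hG

lemma coupling_compl (hx : x ∈ G) (hy : y ∈ G) {ψ : Measure (X × X)}
    (h : IsCoupling (condMeasure 𝔉 μ n x) (condMeasure 𝔉 μ n y) ψ) :
    ψ (block 𝔉 μ n x ×ˢ block 𝔉 μ n y)ᶜ = 0 :=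
  h.compl_prod_eq_zero (hG.measurableSet_block hx) (hG.measurableSet_block hy)
    (hG.compl_block x hx n) (hG.compl_block y hy n)

lemma exists_finset_block_prod (hx : x ∈ G) (hy : y ∈ G) (n : ℕ) :
    ∃ S : Finset (X × X), (S : Set (X × X)) = block 𝔉 μ n x ×ˢ block 𝔉 μ n y :=
  ⟨(hG.finite x hx n).toFinset ×ˢ (hG.finite y hy n).toFinset, by simp⟩

/-- A special coupling induces special couplings of the vertices of the lower levels. -/
lemma isSpecialCoupling_restrict (hx : x ∈ G) (hy : y ∈ G) {m : ℕ} (hm : m ≤ n)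
    {ψ : Measure (X × X)} (h : IsSpecialCoupling 𝔉 μ n x y ψ) {z : X × X}
    (hz₁ : z.1 ∈ block 𝔉 μ n x) (hz₂ : z.2 ∈ block 𝔉 μ n y) (hz : ψ {z} ≠ 0) :
    IsSpecialCoupling 𝔉 μ m z.1 z.2 ((ψ (block 𝔉 μ m z.1 ×ˢ block 𝔉 μ m z.2))⁻¹ •
      ψ.restrict (block 𝔉 μ m z.1 ×ˢ block 𝔉 μ m z.2)) := by
  have := h.coupling.isProbabilityMeasure
  have hz₁G := hG.block_subset x hx n hz₁
  have hz₂G := hG.block_subset y hy n hz₂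
  set D := block 𝔉 μ m z.1 ×ˢ block 𝔉 μ m z.2 with hD
  have hzD : z ∈ D := ⟨hG.mem_block _ hz₁G m, hG.mem_block _ hz₂G m⟩
  have hD0 : ψ D ≠ 0 := fun h0 => hz (measure_mono_null (Set.singleton_subset_iff.2 hzD) h0)
  have hDt : ψ D ≠ ∞ := measure_ne_top _ _
  refine ⟨?_, fun k hk w₁ hw₁ w₂ hw₂ => ?_⟩
  · have := (h.tree m hm z.1 hz₁ z.2 hz₂).smul (ψ D)⁻¹
    simpa [← hD, smul_smul, ENNReal.inv_mul_cancel hD0 hDt] using this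
  · have hw₁G := hG.block_subset _ hz₁G m hw₁
    have hw₂G := hG.block_subset _ hz₂G m hw₂
    have hsub : block 𝔉 μ k w₁ ×ˢ block 𝔉 μ k w₂ ⊆ D := by
      refine Set.prod_mono ?_ ?_
      · rw [← hG.block_eq hz₁G hw₁]; exact hG.block_mono hw₁G hk
      · rw [← hG.block_eq hz₂G hw₂]; exact hG.block_mono hw₂G hk
    have hmeas : MeasurableSet (block 𝔉 μ k w₁ ×ˢ block 𝔉 μ k w₂) :=
      (hG.measurableSet_block hw₁G).prod (hG.measurableSet_block hw₂G)
    have hw₁' : w₁ ∈ block 𝔉 μ n x := by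
      rw [← hG.block_eq hx hz₁]; exact hG.block_mono hz₁G hm hw₁
    have hw₂' : w₂ ∈ block 𝔉 μ n y := by
      rw [← hG.block_eq hy hz₂]; exact hG.block_mono hz₂G hm hw₂
    have := (h.tree k (hk.trans hm) w₁ hw₁' w₂ hw₂').smul (ψ D)⁻¹
    rw [Measure.restrict_smul, Measure.restrict_restrict hmeas, Set.inter_eq_left.2 hsub,
      Measure.smul_apply, Measure.restrict_apply hmeas, Set.inter_eq_left.2 hsub, smul_eq_mul]
    simpa [smul_smul] using this

/-- Transferring a semimetric along the filtration costs at most the integral of the semimetric with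
respect to any special coupling. -/
lemma iterSemimetric_le (r : X → X → ℝ≥0∞) (hx : x ∈ G) (hy : y ∈ G)
    {ψ : Measure (X × X)} (h : IsSpecialCoupling 𝔉 μ n x y ψ) :
    iterSemimetric 𝔉 μ r n x y ≤ ∫⁻ z, r z.1 z.2 ∂ψ := by
  classical
  induction n generalizing x y ψ with
  | zero =>
    have := h.coupling.isProbabilityMeasure
    have h0 := hG.coupling_compl hx hy h.coupling
    have hS : ψ ((({(x, y)} : Finset (X × X)) : Set (X × X)))ᶜ = 0 := by
      simpa [hG.block_zero hx, hG.block_zero hy] using h0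
    have h1 : ψ {(x, y)} = 1 := by
      rw [← prob_compl_eq_zero_iff (measurableSet_singleton _)]
      simpa using hS
    rw [lintegral_eq_sum_of_compl_null hS]
    simp [iterSemimetric, h1]
  | succ n ih =>
    have := h.coupling.isProbabilityMeasure
    obtain ⟨S, hS⟩ := hG.exists_finset_block_prod hx hy (n + 1)
    have hS0 : ψ (S : Set (X × X))ᶜ = 0 := by rw [hS]; exact hG.coupling_compl hx hy h.coupling
    have hmem : ∀ z ∈ S, z.1 ∈ block 𝔉 μ (n + 1) x ∧ z.2 ∈ block 𝔉 μ (n + 1) y := by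
      intro z hz
      rw [← Finset.mem_coe, hS] at hz
      exact hz
    have hmemG : ∀ z ∈ S, z.1 ∈ G ∧ z.2 ∈ G := fun z hz =>
      ⟨hG.block_subset x hx _ (hmem z hz).1, hG.block_subset y hy _ (hmem z hz).2⟩
    let D : X × X → Set (X × X) := fun z => block 𝔉 μ n z.1 ×ˢ block 𝔉 μ n z.2
    have hD : ∀ z ∈ S, ∀ w ∈ D z, D w = D z := fun z hz w hw => by
      simp only [D, hG.block_eq (hmemG z hz).1 hw.1, hG.block_eq (hmemG z hz).2 hw.2]
    have hDm : ∀ z ∈ S, z ∈ D z := fun z hz =>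
      ⟨hG.mem_block _ (hmemG z hz).1 n, hG.mem_block _ (hmemG z hz).2 n⟩
    -- By induction ρ_n at z is at most the average of r over the pair of vertices `D z`, taken with
    -- respect to the normalized restriction of ψ.
    have hstep : ∀ z ∈ S, iterSemimetric 𝔉 μ r n z.1 z.2 * ψ {z} ≤
        ∑ w ∈ S, r w.1 w.2 * ψ {w} * ((if w ∈ D z then ψ {z} else 0) * (ψ (D z))⁻¹) := by
      intro z hz
      by_cases hz0 : ψ {z} = 0
      · simp [hz0]
      · have h1 := ih (hmemG z hz).1 (hmemG z hz).2
          (hG.isSpecialCoupling_restrict hx hy n.le_succ h (hmem z hz).1 (hmem z hz).2 hz0)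
        have hS0' : ψ.restrict (D z) (S : Set (X × X))ᶜ = 0 :=
          le_antisymm ((Measure.restrict_le_self _).trans hS0.le) zero_le
        rw [lintegral_smul_measure, lintegral_eq_sum_of_compl_null hS0'] at h1
        refine (mul_le_mul_left h1 _).trans (le_of_eq ?_)
        rw [smul_eq_mul, Finset.mul_sum, Finset.sum_mul]
        refine Finset.sum_congr rfl fun w hw => ?_
        rw [Measure.restrict_apply (measurableSet_singleton w)]
        by_cases hwD : w ∈ D z
        · rw [if_pos hwD, Set.inter_eq_left.2 (Set.singleton_subset_iff.2 hwD)]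
          ring
        · rw [if_neg hwD, Set.singleton_inter_eq_empty.2 hwD]
          simp
    calc iterSemimetric 𝔉 μ r (n + 1) x y
        ≤ ∫⁻ z, iterSemimetric 𝔉 μ r n z.1 z.2 ∂ψ := iInf₂_le ψ h.coupling
      _ = ∑ z ∈ S, iterSemimetric 𝔉 μ r n z.1 z.2 * ψ {z} := lintegral_eq_sum_of_compl_null hS0 _
      _ ≤ _ := Finset.sum_le_sum hstep
      _ = ∑ w ∈ S, r w.1 w.2 * ψ {w} *
            ∑ z ∈ S, (if w ∈ D z then ψ {z} else 0) * (ψ (D z))⁻¹ := by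
          rw [Finset.sum_comm]
          simp_rw [Finset.mul_sum]
      _ ≤ ∑ w ∈ S, r w.1 w.2 * ψ {w} := by
          refine Finset.sum_le_sum fun w hw => mul_le_of_le_one_right' ?_
          -- The sets `D z` partition the charged pairs, so w collects the weights ψ{z} / ψ(D w) of
          -- the z in its own class, of total at most 1.
          have hle : ∀ z ∈ S, (if w ∈ D z then ψ {z} else 0) * (ψ (D z))⁻¹ ≤
              (if z ∈ D w then ψ {z} else 0) * (ψ (D w))⁻¹ := by
            intro z hz
            by_cases hwz : w ∈ D z
            · simp only [hD z hz w hwz, if_pos hwz, if_pos (hDm z hz), le_refl]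
            · simp [hwz]
          refine (Finset.sum_le_sum hle).trans ?_
          rw [← Finset.sum_mul, ← Finset.sum_filter, sum_measure_singleton]
          refine (mul_le_mul_left (measure_mono (t := D w) fun z hz => ?_) _).trans
            (ENNReal.mul_inv_le_one _)
          simp only [Finset.coe_filter] at hz
          exact hz.2
      _ = ∫⁻ z, r z.1 z.2 ∂ψ := (lintegral_eq_sum_of_compl_null hS0 _).symm

/-- Gluing of special couplings along a coupling of the level above. -/
lemma isSpecialCoupling_sum (hx : x ∈ G) (hy : y ∈ G) {w : Measure (X × X)}
    (hw : IsCoupling (condMeasure 𝔉 μ (n + 1) x) (condMeasure 𝔉 μ (n + 1) y) w)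
    {S : Finset (X × X)} (hS : w (S : Set (X × X))ᶜ = 0)
    (hSb : (S : Set (X × X)) ⊆ block 𝔉 μ (n + 1) x ×ˢ block 𝔉 μ (n + 1) y)
    {ψ : X × X → Measure (X × X)} (hψ : ∀ z ∈ S, IsSpecialCoupling 𝔉 μ n z.1 z.2 (ψ z)) :
    IsSpecialCoupling 𝔉 μ (n + 1) x y (∑ z ∈ S, w {z} • ψ z) := by
  have hprob := hw.isProbabilityMeasure
  have hmemG : ∀ z ∈ S, z.1 ∈ G ∧ z.2 ∈ G := fun z hz =>
    ⟨hG.block_subset x hx _ (hSb hz).1, hG.block_subset y hy _ (hSb hz).2⟩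
  have hmeas := measurable_condMeasure 𝔉 μ n
  have hsum₁ : ∑ z ∈ S, w {z} • condMeasure 𝔉 μ n z.1 = condMeasure 𝔉 μ (n + 1) x := by
    ext s hs
    rw [← hG.bind_eq x hx n, Measure.bind_apply hs hmeas.aemeasurable,
      ← hw.lintegral_fst (f := fun a => condMeasure 𝔉 μ n a s)
        ((Measure.measurable_coe hs).comp hmeas),
      lintegral_eq_sum_of_compl_null hS]
    simp [mul_comm]
  have hsum₂ : ∑ z ∈ S, w {z} • condMeasure 𝔉 μ n z.2 = condMeasure 𝔉 μ (n + 1) y := by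
    ext s hs
    rw [← hG.bind_eq y hy n, Measure.bind_apply hs hmeas.aemeasurable,
      ← hw.lintegral_snd (f := fun a => condMeasure 𝔉 μ n a s)
        ((Measure.measurable_coe hs).comp hmeas),
      lintegral_eq_sum_of_compl_null hS]
    simp [mul_comm]
  have hc : IsCoupling (condMeasure 𝔉 μ (n + 1) x) (condMeasure 𝔉 μ (n + 1) y)
      (∑ z ∈ S, w {z} • ψ z) := by
    rw [← hsum₁, ← hsum₂]
    exact IsCoupling.sum fun z hz => (hψ z hz).coupling.smul _
  refine ⟨hc, fun k hk z₁ hz₁ z₂ hz₂ => ?_⟩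
  have hz₁G := hG.block_subset _ hx _ hz₁
  have hz₂G := hG.block_subset _ hy _ hz₂
  -- At the top level the vertices are the whole blocks and restriction changes nothing.
  rcases hk.eq_or_lt with rfl | hk
  · have := hc.isProbabilityMeasure
    have h0 := hG.coupling_compl hx hy hc
    rw [hG.condMeasure_eq x hx _ z₁ hz₁, hG.condMeasure_eq y hy _ z₂ hz₂,
      hG.block_eq hx hz₁, hG.block_eq hy hz₂,
      Measure.restrict_eq_self_of_ae_mem (s := block 𝔉 μ (n + 1) x ×ˢ block 𝔉 μ (n + 1) y) h0,
      (prob_compl_eq_zero_iff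
        ((hG.measurableSet_block hx).prod (hG.measurableSet_block hy))).1 h0, one_smul, one_smul]
    exact hc
  · have hk : k ≤ n := Nat.lt_succ_iff.1 hk
    set D := block 𝔉 μ k z₁ ×ˢ block 𝔉 μ k z₂ with hD
    have hz : ∀ z ∈ S, IsCoupling (ψ z D • condMeasure 𝔉 μ k z₁) (ψ z D • condMeasure 𝔉 μ k z₂)
        ((ψ z).restrict D) := by
      intro z hz
      by_cases hzb : z₁ ∈ block 𝔉 μ n z.1 ∧ z₂ ∈ block 𝔉 μ n z.2
      · exact (hψ z hz).tree k hk z₁ hzb.1 z₂ hzb.2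
      -- Blocks are nested or disjoint, so vertices outside the blocks of z are not charged by `ψ
      -- z`.
      · refine isCoupling_zero (measure_mono_null
          (t := (block 𝔉 μ n z.1 ×ˢ block 𝔉 μ n z.2)ᶜ) (fun v hv hvz => hzb ?_)
          (hG.coupling_compl (hmemG z hz).1 (hmemG z hz).2 (hψ z hz).coupling))
        have e₁ := hG.block_eq hz₁G (hG.block_mono hz₁G hk hv.1)
        have e₂ := hG.block_eq hz₂G (hG.block_mono hz₂G hk hv.2)
        have f₁ := hG.block_eq (hmemG z hz).1 hvz.1
        have f₂ := hG.block_eq (hmemG z hz).2 hvz.2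
        rw [← f₁, ← f₂, e₁, e₂]
        exact ⟨hG.mem_block _ hz₁G n, hG.mem_block _ hz₂G n⟩
    have h := IsCoupling.sum fun z hz' => (hz z hz').smul (w {z})
    rw [restrict_finset_sum, Measure.finsetSum_apply]
    simp only [Measure.restrict_smul, Measure.smul_apply, Finset.sum_smul]
    simpa [smul_smul] using h

/-- Every value above the iterated semimetric is achieved by a special coupling. -/
lemma exists_isSpecialCoupling (r : X → X → ℝ≥0∞) (hx : x ∈ G) (hy : y ∈ G) {t : ℝ≥0∞}
    (ht : iterSemimetric 𝔉 μ r n x y < t) :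
    ∃ ψ, IsSpecialCoupling 𝔉 μ n x y ψ ∧ ∫⁻ z, r z.1 z.2 ∂ψ < t := by
  classical
  induction n generalizing x y t with
  | zero =>
    have hc : IsCoupling (condMeasure 𝔉 μ 0 x) (condMeasure 𝔉 μ 0 y) (Measure.dirac (x, y)) := by
      rw [hG.zero_eq x hx, hG.zero_eq y hy]
      exact ⟨Measure.map_dirac' measurable_fst _, Measure.map_dirac' measurable_snd _⟩
    refine ⟨Measure.dirac (x, y), ⟨hc, fun k hk z₁ hz₁ z₂ hz₂ => ?_⟩, ?_⟩
    · obtain rfl : k = 0 := Nat.le_zero.1 hk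
      rw [hG.block_zero hx] at hz₁
      rw [hG.block_zero hy] at hz₂
      rw [Set.mem_singleton_iff] at hz₁ hz₂
      subst hz₁ hz₂
      rw [hG.block_zero hx, hG.block_zero hy, Set.singleton_prod_singleton,
        Measure.restrict_eq_self_of_ae_mem (by simp [ae_dirac_eq]),
        Measure.dirac_apply_of_mem (Set.mem_singleton _), one_smul, one_smul]
      exact hc
    · rwa [lintegral_dirac]
  | succ n ih =>
    obtain ⟨w, hw⟩ := iInf_lt_iff.1 ht
    obtain ⟨hwc, hwt⟩ := iInf_lt_iff.1 hw
    have hprob := hwc.isProbabilityMeasure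
    obtain ⟨S, hS⟩ := hG.exists_finset_block_prod hx hy (n + 1)
    have hS0 : w (S : Set (X × X))ᶜ = 0 := by rw [hS]; exact hG.coupling_compl hx hy hwc
    have hmemG : ∀ z ∈ S, z.1 ∈ G ∧ z.2 ∈ G := fun z hz => by
      rw [← Finset.mem_coe, hS] at hz
      exact ⟨hG.block_subset x hx _ hz.1, hG.block_subset y hy _ hz.2⟩
    -- Each lower coupling may exceed its infimum by η; since w has mass 1, the glued coupling loses
    -- at most η.
    obtain ⟨η, hη, hηt⟩ := ENNReal.lt_iff_exists_add_pos_lt.1 hwt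
    rw [lintegral_eq_sum_of_compl_null hS0] at hηt
    have hex : ∀ z, ∃ ψ, z ∈ S → w {z} ≠ 0 → IsSpecialCoupling 𝔉 μ n z.1 z.2 ψ ∧
        ∫⁻ v, r v.1 v.2 ∂ψ ≤ iterSemimetric 𝔉 μ r n z.1 z.2 + η := by
      intro z
      by_cases hz : z ∈ S ∧ w {z} ≠ 0
      -- An infinite value at an atom of w would make the cost of w infinite.
      · have hfin : iterSemimetric 𝔉 μ r n z.1 z.2 ≠ ∞ := by
          intro htop
          have hle := Finset.single_le_sum
            (f := fun z => iterSemimetric 𝔉 μ r n z.1 z.2 * w {z}) (fun _ _ => zero_le) hz.1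
          simp only [htop, ENNReal.top_mul hz.2, top_le_iff] at hle
          rw [hle, top_add] at hηt
          exact not_top_lt hηt
        obtain ⟨ψ, hψ, hlt⟩ := ih (hmemG z hz.1).1 (hmemG z hz.1).2
          (ENNReal.lt_add_right hfin (ENNReal.coe_ne_zero.2 hη.ne'))
        exact ⟨ψ, fun _ _ => ⟨hψ, hlt.le⟩⟩
      · exact ⟨0, fun h1 h2 => absurd ⟨h1, h2⟩ hz⟩
    choose ψ hψ using hex
    -- Good lower couplings were chosen only at atoms of positive weight.
    set S' := S.filter fun z => w {z} ≠ 0 with hS'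
    have hSS' : w (S' : Set (X × X))ᶜ = 0 := by
      have hsub : (S' : Set (X × X))ᶜ ⊆ (S : Set (X × X))ᶜ ∪ ↑(S.filter fun z => w {z} = 0) := by
        intro z hz
        by_cases hzS : z ∈ S
        · right; simpa [hS', hzS] using hz
        · left; simpa using hzS
      refine measure_mono_null hsub (measure_union_null hS0 ?_)
      rw [← sum_measure_singleton]
      exact Finset.sum_eq_zero fun z hz => (Finset.mem_filter.1 hz).2
    have hS'ψ : ∀ z ∈ S', IsSpecialCoupling 𝔉 μ n z.1 z.2 (ψ z) ∧
        ∫⁻ v, r v.1 v.2 ∂ψ z ≤ iterSemimetric 𝔉 μ r n z.1 z.2 + η := fun z hz =>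
      hψ z (Finset.mem_filter.1 hz).1 (Finset.mem_filter.1 hz).2
    refine ⟨∑ z ∈ S', w {z} • ψ z, hG.isSpecialCoupling_sum hx hy hwc hSS' ?_
      fun z hz => (hS'ψ z hz).1, ?_⟩
    · rw [← hS]
      exact Finset.coe_subset.2 (Finset.filter_subset _ _)
    · rw [lintegral_finsetSum_measure]
      calc ∑ z ∈ S', ∫⁻ v, r v.1 v.2 ∂(w {z} • ψ z)
          ≤ ∑ z ∈ S', (iterSemimetric 𝔉 μ r n z.1 z.2 * w {z} + η * w {z}) := by
            refine Finset.sum_le_sum fun z hz => ?_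
            rw [lintegral_smul_measure, smul_eq_mul, ← add_mul, mul_comm]
            exact mul_le_mul_left (hS'ψ z hz).2 _
        _ ≤ ∑ z ∈ S, (iterSemimetric 𝔉 μ r n z.1 z.2 * w {z} + η * w {z}) :=
            Finset.sum_le_sum_of_subset (Finset.filter_subset _ _)
        _ ≤ ∑ z ∈ S, iterSemimetric 𝔉 μ r n z.1 z.2 * w {z} + η := by
            rw [Finset.sum_add_distrib, ← Finset.mul_sum, sum_measure_singleton]
            exact add_le_add_right (mul_le_of_le_one_right' prob_le_one) _
        _ < t := hηt

end IsRegularSet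

end SpecialCoupling

/-! ### A concrete initial metric. -/

section PathMetric

variable {k : ℕ → ℕ}

/-- The standard ultrametric on the space of trajectories. -/
def pathDist (a b : Path k) : ℝ := (PiNat.dist (E := fun n => Fin (k n))).dist a b

lemma pathDist_le_one (a b : Path k) : pathDist a b ≤ 1 := PiNat.dist_le_one a b

lemma pathDist_le_of_forall_lt {a b : Path k} {m : ℕ} (h : ∀ i < m, a i = b i) :
    pathDist a b ≤ (1 / 2) ^ m :=
  PiNat.mem_cylinder_iff_dist_le.1 h

/-- The approximating cylinder semimetrics replace the coordinates from i on by those of `a₀`; the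
truncated trajectories converge to the original ones and the distance is continuous. -/
lemma isInitialMetric_pathDist (a₀ : Path k) : IsInitialMetric (pathDist (k := k)) := by
  let _ : MetricSpace (Path k) := PiNat.metricSpace (E := fun n => Fin (k n))
  have hdist : ∀ a b : Path k, pathDist a b = dist a b := fun _ _ => rfl
  let trunc : ℕ → Path k → Path k := fun i a j => if j < i then a j else a₀ j
  have htrunc : ∀ a, Tendsto (fun i => trunc i a) atTop (𝓝 a) := fun a =>
    tendsto_pi_nhds.2 fun j => tendsto_const_nhds.congr'
      ((eventually_gt_atTop j).mono fun i hi => (if_pos hi).symm)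
  refine ⟨fun a b => by rw [hdist]; exact dist_eq_zero, fun a b => by
    rw [hdist, hdist]; exact dist_comm a b, fun a b c => by
    simp only [hdist]; exact dist_triangle a b c, fun a => ?_,
    fun i a b => pathDist (trunc i a) (trunc i b), fun i => ?_, fun a b => ?_⟩
  · convert! Metric.nhds_basis_ball (x := a) using 3 with ε
    ext b
    simp only [hdist, Metric.mem_ball, dist_comm]
    rfl
  · refine ⟨fun a b => ?_, fun a => ?_, fun a b => ?_, fun a b c => ?_, i,
      fun a a' b b' ha hb => ?_⟩
    · simp only [hdist]; exact dist_nonneg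
    · simp only [hdist]; exact dist_self _
    · simp only [hdist]; exact dist_comm _ _
    · simp only [hdist]; exact dist_triangle _ _ _
    · have e : ∀ a a' : Path k, (∀ j < i, a j = a' j) → trunc i a = trunc i a' := by
        intro a a' h
        ext j
        by_cases hj : j < i
        · simp only [trunc, if_pos hj, h j hj]
        · simp only [trunc, if_neg hj]
      simp only [e a a' ha, e b b' hb]
  · simp only [hdist]
    exact (htrunc a).dist (htrunc b)

end PathMetric

/-! ### Estimates for non-measurable functions and sets. -/

section LowerIntegral

variable {Y : Type*} [MeasurableSpace Y] {ν : Measure Y} [IsProbabilityMeasure ν]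

/-- An upper bound of a lower integral by the values on a set of large outer measure. -/
lemma lintegral_le_add_of_lt_measureReal {f : Y → ℝ≥0∞} {S : Set Y} {c : ℝ≥0∞} {ε : ℝ}
    (hf : ∀ y, f y ≤ 1) (hS : ∀ᵐ y ∂ν, y ∈ S → f y ≤ c) (h : 1 - ε < ν.real S) :
    ∫⁻ y, f y ∂ν ≤ c + ENNReal.ofReal ε := by
  -- The integral of f is attained by a measurable minorant g, and {g ≤ c} is a measurable set
  -- containing S up to a null set.
  obtain ⟨g, hg, hgf, hint⟩ := exists_measurable_le_lintegral_eq (μ := ν) f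
  have hm : MeasurableSet {y | g y ≤ c} := hg measurableSet_Iic
  have hle : ν.real S ≤ ν.real {y | g y ≤ c} := by
    refine ENNReal.toReal_mono (measure_ne_top _ _) (measure_mono_ae ?_)
    filter_upwards [hS] with y hy hyS using (hgf y).trans (hy hyS)
  have hcompl : ν {y | g y ≤ c}ᶜ ≤ ENNReal.ofReal ε := by
    rw [← ofReal_measureReal (measure_ne_top _ _), probReal_compl_eq_one_sub hm]
    exact ENNReal.ofReal_le_ofReal (by linarith)
  rw [hint]
  calc ∫⁻ y, g y ∂ν ≤ ∫⁻ y, c + {y | g y ≤ c}ᶜ.indicator 1 y ∂ν := by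
        refine lintegral_mono fun y => ?_
        by_cases hy : g y ≤ c
        · exact hy.trans le_self_add
        · rw [Set.indicator_of_mem (by simpa using hy), Pi.one_apply]
          exact ((hgf y).trans (hf y)).trans le_add_self
    _ = c + ν {y | g y ≤ c}ᶜ := by
        rw [lintegral_add_left measurable_const, lintegral_indicator_one hm.compl]
        simp
    _ ≤ c + ENNReal.ofReal ε := add_le_add_right hcompl c

/-- A lower bound of an outer measure from the lower integral of a function. -/
lemma one_le_measure_add_of_lintegral {g : Y → ℝ≥0∞} {S A : Set Y} (hA : MeasurableSet A)
    {δ : ℝ≥0∞} (hδ : δ ≠ 0) (hδ' : δ ≠ ∞) (h : ∀ᵐ y ∂ν, y ∈ A → g y < δ → y ∈ S) :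
    1 ≤ ν S + ν Aᶜ + (∫⁻ y, g y ∂ν) / δ := by
  -- Outside the measurable hull T of S and inside A one has g ≥ δ almost everywhere, so Markov's
  -- inequality bounds that set.
  set T := toMeasurable ν S with hT
  have hTm : MeasurableSet T := measurableSet_toMeasurable ν S
  have hTA : MeasurableSet (Tᶜ ∩ A) := hTm.compl.inter hA
  have h1 : ν (Tᶜ ∩ A) ≤ (∫⁻ y, g y ∂ν) / δ := by
    rw [ENNReal.le_div_iff_mul_le (Or.inl hδ) (Or.inl hδ'), mul_comm]
    calc δ * ν (Tᶜ ∩ A) = ∫⁻ _ in Tᶜ ∩ A, δ ∂ν := (setLIntegral_const _ _).symm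
      _ ≤ ∫⁻ y in Tᶜ ∩ A, g y ∂ν := by
          refine lintegral_mono_ae ((ae_restrict_iff' hTA).2 ?_)
          filter_upwards [h] with y hy hyT
          by_contra hlt
          exact hyT.1 (subset_toMeasurable ν S (hy hyT.2 (not_le.1 hlt)))
      _ ≤ ∫⁻ y, g y ∂ν := setLIntegral_le_lintegral _ _
  calc (1 : ℝ≥0∞) = ν Set.univ := measure_univ.symm
    _ ≤ ν (T ∪ Aᶜ ∪ (Tᶜ ∩ A)) := by
        refine measure_mono fun y _ => ?_
        by_cases h1 : y ∈ T <;> by_cases h2 : y ∈ A <;> simp [h1, h2]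
    _ ≤ ν T + ν Aᶜ + ν (Tᶜ ∩ A) :=
        (measure_union_le _ _).trans (add_le_add_left (measure_union_le _ _) _)
    _ ≤ ν S + ν Aᶜ + (∫⁻ y, g y ∂ν) / δ := by
        rw [hT, measure_toMeasurable]
        exact add_le_add_right h1 _

end LowerIntegral

/-! ### The criterion implies standardness of every chain. -/

section CriterionToStandard

variable {X : Type*} [MeasurableSpace X]

lemma ae_prod_of_ae {μ : Measure X} [SFinite μ] {p : X → Prop} (h : ∀ᵐ x ∂μ, p x) :
    ∀ᵐ q ∂μ.prod μ, p q.1 ∧ p q.2 :=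
  (Measure.quasiMeasurePreserving_fst.ae h).and (Measure.quasiMeasurePreserving_snd.ae h)

lemma IsCoupling.ae_fst {α β : Measure X} {ψ : Measure (X × X)} (h : IsCoupling α β ψ)
    {p : X → Prop} (hp : ∀ᵐ x ∂α, p x) : ∀ᵐ z ∂ψ, p z.1 := by
  rw [← h.1] at hp
  exact ae_of_ae_map measurable_fst.aemeasurable hp

lemma IsCoupling.ae_snd {α β : Measure X} {ψ : Measure (X × X)} (h : IsCoupling α β ψ)
    {p : X → Prop} (hp : ∀ᵐ x ∂β, p x) : ∀ᵐ z ∂ψ, p z.2 := by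
  rw [← h.2] at hp
  exact ae_of_ae_map measurable_snd.aemeasurable hp

variable [StandardBorelSpace X]

lemma iterSemimetric_le_of_le (𝔉 : DecFiltration X) (μ : Measure X) [IsFiniteMeasure μ]
    {r : X → X → ℝ≥0∞} {c : ℝ≥0∞} (hr : ∀ x y, r x y ≤ c) (n : ℕ) (x y : X) :
    iterSemimetric 𝔉 μ r n x y ≤ c := by
  induction n generalizing x y with
  | zero => exact hr x y
  | succ n ih =>
    refine (iInf₂_le ((condMeasure 𝔉 μ (n + 1) x).prod (condMeasure 𝔉 μ (n + 1) y))
      ⟨by simp, by simp⟩).trans ?_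
    exact (lintegral_mono (g := fun _ => c) fun p : X × X => ih p.1 p.2).trans (by simp)

variable {𝔉 : DecFiltration X} {μ : Measure X} [IsProbabilityMeasure μ]

/-- The indicator of a tail set s is constant on almost every block of every level, so every special
coupling has cost |1_s(x₁) - 1_s(x₂)|. The criterion then makes s × sᶜ null, whence μ(s)μ(sᶜ) = 0.
-/
lemma StandardnessCriterion.isErgodic (h : StandardnessCriterion 𝔉 μ) : IsErgodic 𝔉 μ := by
  classical
  intro s hs
  have hsm : MeasurableSet s := 𝔉.alg_le 0 s (hs 0)
  set f : X → ℝ := s.indicator 1 with hf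
  have hfm : MemLp f ∞ μ := (memLp_const (1 : ℝ)).indicator hsm
  have key : ∀ n, ∀ᵐ p ∂μ.prod μ, ∀ ψ, IsSpecialCoupling 𝔉 μ n p.1 p.2 ψ →
      ∫⁻ z, ENNReal.ofReal |f z.1 - f z.2| ∂ψ = ENNReal.ofReal |f p.1 - f p.2| := by
    intro n
    have hfn : Measurable[𝔉.alg n] f := 
      Measurable.indicator (@measurable_const ℝ X _ (𝔉.alg n) 1) (hs n)
    filter_upwards [ae_prod_of_ae (ae_condMeasure_ae_eq 𝔉 μ n hfn)] with p hp ψ hψ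
    have := hψ.coupling.isProbabilityMeasure
    rw [lintegral_congr_ae (g := fun _ => ENNReal.ofReal |f p.1 - f p.2|)]
    · simp
    · filter_upwards [hψ.coupling.ae_fst hp.1, hψ.coupling.ae_snd hp.2] with z h1 h2
      rw [h1, h2]
  have hE : ∀ ε : ℝ, 0 < ε → ε ≤ 1 → (μ.prod μ).real (s ×ˢ sᶜ) < ε := by
    intro ε hε hε1
    obtain ⟨N, hN⟩ := h f hfm ε hε
    have h1 := hN (N + 1) N.lt_succ_self
    have hm : MeasurableSet (s ×ˢ sᶜ) := hsm.prod hsm.compl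
    have h2 : (μ.prod μ).real {p | ∃ ψ, IsSpecialCoupling 𝔉 μ (N + 1) p.1 p.2 ψ ∧
        ∫⁻ z, ENNReal.ofReal |f z.1 - f z.2| ∂ψ < ENNReal.ofReal ε} ≤
        (μ.prod μ).real (s ×ˢ sᶜ)ᶜ := by
      refine ENNReal.toReal_mono (measure_ne_top _ _) (measure_mono_ae ?_)
      filter_upwards [key (N + 1)] with p hp hpS hpE
      obtain ⟨ψ, hψ, hlt⟩ := hpS
      rw [hp ψ hψ, hf, Set.indicator_of_mem hpE.1, Set.indicator_of_notMem hpE.2] at hlt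
      rw [ENNReal.ofReal_lt_ofReal_iff hε] at hlt
      simp at hlt
      linarith
    rw [probReal_compl_eq_one_sub hm] at h2
    linarith
  have h0 : (μ.prod μ).real (s ×ˢ sᶜ) = 0 := by
    refine le_antisymm (le_of_forall_pos_lt_add fun ε hε => ?_) measureReal_nonneg
    rw [zero_add]
    exact (hE (min ε 1) (by positivity) (min_le_right _ _)).trans_le (min_le_left _ _)
  rw [measureReal_eq_zero_iff, Measure.prod_prod, mul_eq_zero, prob_compl_eq_zero_iff hsm] at h0
  exact h0

/-- A bounded function which separates trajectories with different initial segments. -/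
lemma exists_memLp_separating {Y : Type*} [MeasurableSpace Y] {μ : Measure Y} {k : ℕ → ℕ}
    {Φ : Y → Path k} (hΦ : Measurable Φ) (m : ℕ) :
    ∃ f : Y → ℝ, MemLp f ∞ μ ∧ ∀ x y, (∀ i < m, Φ x i = Φ y i) ∨ 1 ≤ |f x - f y| := by
  let e := Fintype.equivFin (∀ i : Fin m, Fin (k i))
  let pre : Y → ∀ i : Fin m, Fin (k i) := fun x i => Φ x i
  have hpre : Measurable pre :=
    measurable_pi_lambda _ fun i => (measurable_pi_apply (i : ℕ)).comp hΦ
  have hfm : Measurable fun x => ((e (pre x) : ℕ) : ℝ) :=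
    (measurable_of_finite fun u => ((e u : ℕ) : ℝ)).comp hpre
  refine ⟨fun x => ((e (pre x) : ℕ) : ℝ), memLp_top_of_bound hfm.aestronglyMeasurable
    (Fintype.card (∀ i : Fin m, Fin (k i)) : ℝ) (ae_of_all _ fun x => ?_), fun x y => ?_⟩
  · rw [Real.norm_of_nonneg (Nat.cast_nonneg _)]
    exact Nat.cast_le.2 (Fin.is_lt _).le
  · by_cases hxy : pre x = pre y
    · exact Or.inl fun i hi => congrFun hxy ⟨i, hi⟩
    · have hne : (e (pre x) : ℕ) ≠ e (pre y) := fun h => hxy (e.injective (Fin.ext h))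
      have : (1 : ℤ) ≤ |((e (pre x) : ℕ) : ℤ) - ((e (pre y) : ℕ) : ℤ)| :=
        Int.one_le_abs (sub_ne_zero.2 (by exact_mod_cast hne))
      right
      have h2 := (Int.cast_le (R := ℝ)).2 this
      push_cast at h2
      exact h2

/-- The criterion implies that the iterated semimetrics of any process collapse in mean. -/
lemma StandardnessCriterion.tendsto_lintegral_pathDist (h𝔉 : IsFiniteType 𝔉 μ)
    (h : StandardnessCriterion 𝔉 μ) {k : ℕ → ℕ} {Φ : X → Path k} (hΦ : Measurable Φ) :
    Tendsto (fun n => ∫⁻ p, iterSemimetric 𝔉 μ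
      (fun x y => ENNReal.ofReal (pathDist (Φ x) (Φ y))) n p.1 p.2 ∂(μ.prod μ)) atTop (𝓝 0) := by
  classical
  obtain ⟨G, hG, hGae, -⟩ := h𝔉.exists_isRegularSet (p := fun _ => True) (by simp)
  rw [ENNReal.tendsto_nhds_zero]
  intro e he
  -- One δ each for the cost of f, for the coordinates from m on, and for the exceptional pairs.
  obtain ⟨δ, hδ, hδe⟩ : ∃ δ : ℝ, 0 < δ ∧ ENNReal.ofReal (δ + δ + δ) ≤ e := by
    obtain ⟨a, ha, hae⟩ := ENNReal.lt_iff_exists_nnreal_btwn.1 he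
    refine ⟨a / 3, by have : (0 : ℝ) < a := by exact_mod_cast ha
                      positivity, ?_⟩
    rw [show (a / 3 + a / 3 + a / 3 : ℝ) = a by ring, ENNReal.ofReal_coe_nnreal]
    exact hae.le
  obtain ⟨m, hm⟩ := exists_pow_lt_of_lt_one hδ (by norm_num : (1 / 2 : ℝ) < 1)
  obtain ⟨f, hfL, hf⟩ := exists_memLp_separating hΦ m (μ := μ)
  have hpt : ∀ x y, ENNReal.ofReal (pathDist (Φ x) (Φ y)) ≤
      ENNReal.ofReal |f x - f y| + ENNReal.ofReal δ := by
    intro x y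
    rcases hf x y with hxy | hxy
    · exact (ENNReal.ofReal_le_ofReal
        ((pathDist_le_of_forall_lt hxy).trans hm.le)).trans le_add_self
    · exact (ENNReal.ofReal_le_ofReal ((pathDist_le_one _ _).trans hxy)).trans le_self_add
  obtain ⟨N, hN⟩ := h f hfL δ hδ
  filter_upwards [eventually_gt_atTop N] with n hn
  refine (lintegral_le_add_of_lt_measureReal (c := ENNReal.ofReal δ + ENNReal.ofReal δ)
    (fun p => iterSemimetric_le_of_le 𝔉 μ (fun x y => ?_) n p.1 p.2) ?_ (hN n hn)).trans ?_
  · exact (ENNReal.ofReal_le_ofReal (pathDist_le_one _ _)).trans (by simp)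
  · filter_upwards [ae_prod_of_ae hGae] with p hp ⟨ψ, hψ, hlt⟩
    have := hψ.coupling.isProbabilityMeasure
    refine (hG.iterSemimetric_le _ hp.1 hp.2 hψ).trans ((lintegral_mono fun z : X × X => hpt z.1 z.2).trans ?_)
    rw [lintegral_add_right _ measurable_const]
    refine add_le_add hlt.le ?_
    simp
  · rwa [← ENNReal.ofReal_add hδ.le hδ.le, ← ENNReal.ofReal_add (by positivity) hδ.le]

lemma StandardnessCriterion.isStandardChain (h𝔉 : IsFiniteType 𝔉 μ)
    (h : StandardnessCriterion 𝔉 μ) {k : ℕ → ℕ} {Φ : X → Path k} (hΦ : Measurable Φ) :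
    IsStandardChain 𝔉 μ Φ := by
  obtain ⟨x₀⟩ : Nonempty X := nonempty_of_isProbabilityMeasure μ
  exact ⟨h.isErgodic, pathDist, isInitialMetric_pathDist (Φ x₀),
    h.tendsto_lintegral_pathDist h𝔉 hΦ⟩

end CriterionToStandard

/-! ### Standardness of a generating chain implies the criterion. -/

section StandardToCriterion

lemma IsInitialMetric.nonneg {k : ℕ → ℕ} {ρ : Path k → Path k → ℝ} (hρ : IsInitialMetric ρ)
    (a b : Path k) : 0 ≤ ρ a b := by
  have := hρ.triangle a b a
  rw [hρ.symm b a, (hρ.eq_zero_iff a a).2 rfl] at this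
  linarith

/-- An initial metric is uniformly larger than the separation of initial segments. -/
lemma IsInitialMetric.exists_pos_forall_eq {k : ℕ → ℕ} {ρ : Path k → Path k → ℝ}
    (hρ : IsInitialMetric ρ) (m : ℕ) :
    ∃ c : ℝ, 0 < c ∧ ∀ a b, ρ a b < c → ∀ i < m, a i = b i := by
  have h1 : ∀ a : Path k, ∃ ε : ℝ, 0 < ε ∧ ∀ b, ρ a b < ε → ∀ i < m, b i = a i := by
    intro a
    have hn : {b : Path k | ∀ i < m, b i = a i} ∈ 𝓝 a := by
      have : ∀ᶠ b : Path k in 𝓝 a, ∀ i ∈ Finset.range m, b i = a i := by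
        refine (Finset.eventually_all _).2 fun i _ => ?_
        exact ((continuous_apply i).tendsto a).eventually
          ((isOpen_discrete {a i}).mem_nhds rfl)
      filter_upwards [this] with b hb i hi using hb i (Finset.mem_range.2 hi)
    obtain ⟨ε, hε, hsub⟩ := (hρ.topology a).mem_iff.1 hn
    exact ⟨ε, hε, fun b hb => hsub hb⟩
  choose ε hε hball using h1
  -- A Lebesgue number argument: the cover uses half radii, so if x is in a half ball and ρ(x, y) <
  -- c, then both x and y are in the full ball, where the first m coordinates are constant.
  obtain ⟨t, -, ht⟩ := isCompact_univ.elim_nhds_subcover (fun a => {b | ρ a b < ε a / 2})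
    fun a _ => (hρ.topology a).mem_of_mem (half_pos (hε a))
  have hc : ∀ᶠ c : ℝ in 𝓝[>] 0, 0 < c ∧ ∀ a ∈ t, c < ε a / 2 := by
    refine eventually_mem_nhdsWithin.and ((Finset.eventually_all _).2 fun a _ => ?_)
    exact nhdsWithin_le_nhds (eventually_lt_nhds (half_pos (hε a)))
  obtain ⟨c, hc0, hct⟩ := hc.exists
  refine ⟨c, hc0, fun x y hxy i hi => ?_⟩
  obtain ⟨a, hat, hax⟩ := Set.mem_iUnion₂.1 (ht (Set.mem_univ x))
  have hax : ρ a x < ε a / 2 := hax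
  have h2 := hρ.triangle a x y
  have h3 := hct a hat
  rw [hball a x (by linarith [hε a]) i hi, hball a y (by linarith) i hi]

variable {X : Type*} [mX : MeasurableSpace X] {μ : Measure X} [IsProbabilityMeasure μ]

/-- The initial segment of a trajectory. -/
def initialSegment {k : ℕ → ℕ} (m : ℕ) (a : Path k) : ∀ i : Fin m, Fin (k i) := fun i => a i

lemma measurable_initialSegment {k : ℕ → ℕ} (m : ℕ) : Measurable (initialSegment (k := k) m) :=
  measurable_pi_lambda _ fun i => measurable_pi_apply (i : ℕ)

/-- Integrable functions are approximated in mean by functions of finitely many coordinates. -/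
lemma exists_lintegral_initialSegment_lt {k : ℕ → ℕ} {Φ : X → Path k} (hΦ : Measurable Φ)
    (hgen : ∀ s, MeasurableSet s → ∃ t, MeasurableSet[tailAlg Φ 0] t ∧ s =ᵐ[μ] t)
    {f : X → ℝ} (hf : Integrable f μ) {η : ℝ≥0∞} (hη : 0 < η) :
    ∃ (m : ℕ) (F : (∀ i : Fin m, Fin (k i)) → ℝ),
      ∫⁻ x, ENNReal.ofReal |f x - F (initialSegment m (Φ x))| ∂μ < η := by
  let ℱ : Filtration ℕ mX :=
    { seq := fun m => MeasurableSpace.comap (fun x => initialSegment m (Φ x)) inferInstance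
      mono' := by
        intro m n hmn
        let res : (∀ i : Fin n, Fin (k i)) → ∀ i : Fin m, Fin (k i) :=
          fun a i => a ⟨i, i.2.trans_le hmn⟩
        have : (fun x => initialSegment m (Φ x)) = res ∘ fun x => initialSegment n (Φ x) := rfl
        simp only
        rw [this, ← MeasurableSpace.comap_comp]
        exact MeasurableSpace.comap_mono (measurable_of_finite res).comap_le
      le' := fun m => ((measurable_initialSegment m).comp hΦ).comap_le }
  have hle : (⨆ n, ℱ n) ≤ mX := iSup_le fun n => ℱ.le n
  have htail : tailAlg Φ 0 ≤ ⨆ n, ℱ n := by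
    refine iSup₂_le fun m _ => le_trans ?_ (le_iSup _ (m + 1))
    have : (fun x => Φ x m) = (fun a : ∀ i : Fin (m + 1), Fin (k i) => a (Fin.last m)) ∘
        fun x => initialSegment (m + 1) (Φ x) := rfl
    rw [this, ← MeasurableSpace.comap_comp]
    exact MeasurableSpace.comap_mono (measurable_of_finite _).comap_le
  -- Every measurable set is a set of the generated σ-algebra modulo null sets, so f is its own
  -- conditional expectation; Lévy's upward theorem then gives the approximation in L¹.
  have hcond : f =ᵐ[μ] μ[f|⨆ n, ℱ n] := by
    refine hf.ae_eq_of_forall_setIntegral_eq _ _ integrable_condExp fun s hs _ => ?_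
    obtain ⟨t, ht, hst⟩ := hgen s hs
    rw [setIntegral_congr_set hst, setIntegral_congr_set hst, setIntegral_condExp hle hf]
    exact htail _ ht
  have hlim := tendsto_eLpNorm_condExp (μ := μ) (ℱ := ℱ) f
  obtain ⟨m, hm⟩ := (hlim.eventually_lt_const hη).exists
  have hmeas : StronglyMeasurable[ℱ m] (μ[f|ℱ m]) := stronglyMeasurable_condExp
  obtain ⟨F, -, hF⟩ := hmeas.exists_eq_measurable_comp
  refine ⟨m, F, ?_⟩
  rw [eLpNorm_one_eq_lintegral_enorm] at hm
  refine lt_of_eq_of_lt (lintegral_congr_ae ?_) hm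
  filter_upwards [hcond] with x hx
  rw [hx, Pi.sub_apply, hF, ← ofReal_norm, Real.norm_eq_abs, abs_sub_comm]
  rfl

variable [StandardBorelSpace X] {𝔉 : DecFiltration X}

/-- Collapse of the iterated semimetrics of a generating process implies the criterion. -/
lemma standardnessCriterion_of_tendsto (h𝔉 : IsFiniteType 𝔉 μ) {k : ℕ → ℕ} {Φ : X → Path k}
    (hΦ : Measurable Φ)
    (hgen : ∀ s, MeasurableSet s → ∃ t, MeasurableSet[tailAlg Φ 0] t ∧ s =ᵐ[μ] t)
    {ρ : Path k → Path k → ℝ} (hρ : IsInitialMetric ρ)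
    (hlim : Tendsto (fun n => ∫⁻ p, iterSemimetric 𝔉 μ
      (fun x y => ENNReal.ofReal (ρ (Φ x) (Φ y))) n p.1 p.2 ∂(μ.prod μ)) atTop (𝓝 0)) :
    StandardnessCriterion 𝔉 μ := by
  intro f hf ε hε
  have hε4 : 0 < ε / 4 := by positivity
  -- By Markov's inequality the block averages of the error exceed ε/4 only on a set of measure at
  -- most ε/8.
  obtain ⟨m, F, hF⟩ := exists_lintegral_initialSegment_lt hΦ hgen
    (hf.integrable le_top) (ENNReal.ofReal_pos.2 (by positivity : 0 < ε / 4 * (ε / 8)))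
  obtain ⟨c, hc, hcut⟩ := hρ.exists_pos_forall_eq m
  obtain ⟨K, hK⟩ : ∃ K : ℝ, ∀ u v, |F u - F v| ≤ K := by
    obtain ⟨K, hK⟩ := (Set.finite_range fun q : (∀ i : Fin m, Fin (k i)) ×
      (∀ i : Fin m, Fin (k i)) => |F q.1 - F q.2|).bddAbove
    exact ⟨K, fun u v => hK ⟨(u, v), rfl⟩⟩
  -- Where ρ < c the initial segments agree; elsewhere K ≤ (|K| / c) ρ.
  have hKρ : ∀ a b, |F (initialSegment m a) - F (initialSegment m b)| ≤ (|K| / c) * ρ a b := by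
    intro a b
    by_cases hab : ρ a b < c
    · have : initialSegment m a = initialSegment m b := funext fun i => hcut a b hab i i.2
      rw [this, sub_self, abs_zero]
      have h0 := hρ.nonneg a b
      positivity
    · rw [div_mul_eq_mul_div, le_div_iff₀ hc]
      exact mul_le_mul ((hK _ _).trans (le_abs_self K)) (not_lt.1 hab) hc.le (abs_nonneg K)
  set f₀ : X → ℝ := hf.1.mk f with hf₀
  have hf₀m : Measurable f₀ := hf.1.stronglyMeasurable_mk.measurable
  have hff₀ : f =ᵐ[μ] f₀ := hf.1.ae_eq_mk
  set h : X → ℝ≥0∞ := fun x => ENNReal.ofReal |f₀ x - F (initialSegment m (Φ x))| with hh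
  have hFm : Measurable fun x => F (initialSegment m (Φ x)) :=
    (measurable_of_finite F).comp ((measurable_initialSegment m).comp hΦ)
  have hhm : Measurable h := (hf₀m.sub hFm).abs.ennreal_ofReal
  have hhint : ∫⁻ x, h x ∂μ ≤ ENNReal.ofReal (ε / 4) * ENNReal.ofReal (ε / 8) := by
    rw [← ENNReal.ofReal_mul hε4.le]
    refine le_trans (le_of_eq (lintegral_congr_ae ?_)) hF.le
    filter_upwards [hff₀] with x hx
    rw [hh, hx]
  obtain ⟨G, hG, hGae, hGf⟩ := h𝔉.exists_isRegularSet
    (ae_all_iff.2 fun n => ae_condMeasure_ae 𝔉 n hff₀)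
  set κ : ℝ := |K| / c + 1 with hκ
  have hκ0 : 0 < κ := by positivity
  have hpt : ∀ z : X × X, f z.1 = f₀ z.1 → f z.2 = f₀ z.2 → ENNReal.ofReal |f z.1 - f z.2| ≤
      h z.1 + h z.2 + ENNReal.ofReal κ * ENNReal.ofReal (ρ (Φ z.1) (Φ z.2)) := by
    intro z h1 h2
    rw [h1, h2, ← ENNReal.ofReal_mul hκ0.le]
    have h3 := hKρ (Φ z.1) (Φ z.2)
    have h0 := hρ.nonneg (Φ z.1) (Φ z.2)
    rw [hh, ← ENNReal.ofReal_add (abs_nonneg _) (abs_nonneg _),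
      ← ENNReal.ofReal_add (by positivity) (by positivity)]
    refine ENNReal.ofReal_le_ofReal ?_
    have h4 := abs_sub_le (f₀ z.1) (F (initialSegment m (Φ z.1))) (f₀ z.2)
    have h5 := abs_sub_le (F (initialSegment m (Φ z.1))) (F (initialSegment m (Φ z.2))) (f₀ z.2)
    rw [abs_sub_comm (F (initialSegment m (Φ z.2))) (f₀ z.2)] at h5
    have h6 : (|K| / c) * ρ (Φ z.1) (Φ z.2) ≤ κ * ρ (Φ z.1) (Φ z.2) :=
      mul_le_mul_of_nonneg_right (by rw [hκ]; linarith) h0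
    linarith
  -- A coupling of ρ-cost below δ contributes at most κδ = ε/4 to the cost of f, and each of the two
  -- block averages adds less than ε/4.
  set δ : ℝ≥0∞ := ENNReal.ofReal (ε / 4 / κ) with hδ
  have hδ0 : δ ≠ 0 := (ENNReal.ofReal_pos.2 (by positivity)).ne'
  have hκδ : ENNReal.ofReal κ * δ = ENNReal.ofReal (ε / 4) := by
    rw [hδ, ← ENNReal.ofReal_mul hκ0.le, mul_div_cancel₀ _ hκ0.ne']
  have hδε : (0 : ℝ≥0∞) < δ * ENNReal.ofReal (ε / 4) :=
    ENNReal.mul_pos hδ0 (ENNReal.ofReal_pos.2 hε4).ne'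
  obtain ⟨N, hN⟩ := eventually_atTop.1 (hlim.eventually_le_const hδε)
  refine ⟨N, fun n hn => ?_⟩
  set u : X → ℝ≥0∞ := fun x => ∫⁻ y, h y ∂condMeasure 𝔉 μ n x with hu
  have hum : Measurable u := (Measure.measurable_lintegral hhm).comp (measurable_condMeasure 𝔉 μ n)
  have huint : ∫⁻ x, u x ∂μ = ∫⁻ x, h x ∂μ := lintegral_condMeasure 𝔉 μ n hhm
  set U : Set X := {x | ENNReal.ofReal (ε / 4) ≤ u x} with hU
  have hUm : MeasurableSet U := hum measurableSet_Ici
  have hUle : μ U ≤ ENNReal.ofReal (ε / 8) := by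
    have h1 := mul_meas_ge_le_lintegral (μ := μ) hum (ENNReal.ofReal (ε / 4))
    rw [huint] at h1
    exact (ENNReal.mul_le_mul_iff_right (ENNReal.ofReal_pos.2 hε4).ne' ENNReal.ofReal_ne_top).1
      (h1.trans hhint)
  have key := one_le_measure_add_of_lintegral (ν := μ.prod μ) (A := Uᶜ ×ˢ Uᶜ)
    (S := {p | ∃ ψ, IsSpecialCoupling 𝔉 μ n p.1 p.2 ψ ∧
      ∫⁻ z, ENNReal.ofReal |f z.1 - f z.2| ∂ψ < ENNReal.ofReal ε})
    (g := fun p => iterSemimetric 𝔉 μ (fun x y => ENNReal.ofReal (ρ (Φ x) (Φ y))) n p.1 p.2)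
    (hUm.compl.prod hUm.compl) hδ0 ENNReal.ofReal_ne_top ?_
  -- The bad pairs have measure at most 2 · ε/8 from U and ε/4 from the mean of ρ_n, together ε/2 <
  -- ε.
  · have hA : (μ.prod μ) (Uᶜ ×ˢ Uᶜ)ᶜ ≤ ENNReal.ofReal (ε / 8) + ENNReal.ofReal (ε / 8) := by
      rw [Set.compl_prod_eq_union, compl_compl]
      refine (measure_union_le _ _).trans (add_le_add ?_ ?_) <;> simpa using hUle
    have hI := ENNReal.div_le_of_le_mul' (hN n hn.le)
    have h1 := key.trans (add_le_add (add_le_add_right hA _) hI)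
    rw [← ofReal_measureReal (measure_ne_top _ _), ← ENNReal.ofReal_add (by positivity)
      (by positivity), ← ENNReal.ofReal_add (by positivity) (by positivity),
      ← ENNReal.ofReal_add (by positivity) (by positivity), ENNReal.one_le_ofReal] at h1
    linarith
  · filter_upwards [ae_prod_of_ae hGae] with p hp hpA hlt
    obtain ⟨ψ, hψ, hψlt⟩ := hG.exists_isSpecialCoupling _ hp.1 hp.2 hlt
    refine ⟨ψ, hψ, ?_⟩
    have hu₁ : u p.1 < ENNReal.ofReal (ε / 4) := not_le.1 hpA.1
    have hu₂ : u p.2 < ENNReal.ofReal (ε / 4) := not_le.1 hpA.2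
    calc ∫⁻ z, ENNReal.ofReal |f z.1 - f z.2| ∂ψ
        ≤ ∫⁻ z, h z.1 + h z.2 + ENNReal.ofReal κ * ENNReal.ofReal (ρ (Φ z.1) (Φ z.2)) ∂ψ := by
          refine lintegral_mono_ae ?_
          filter_upwards [hψ.coupling.ae_fst (hGf p.1 hp.1 n), hψ.coupling.ae_snd (hGf p.2 hp.2 n)]
            with z h1 h2 using hpt z h1 h2
      _ = u p.1 + u p.2 + ENNReal.ofReal κ * ∫⁻ z, ENNReal.ofReal (ρ (Φ z.1) (Φ z.2)) ∂ψ := by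
          rw [lintegral_add_left (f := fun z : X × X => h z.1 + h z.2)
              ((hhm.comp measurable_fst).add (hhm.comp measurable_snd)),
            lintegral_add_left (f := fun z : X × X => h z.1) (hhm.comp measurable_fst), hψ.coupling.lintegral_fst hhm,
            hψ.coupling.lintegral_snd hhm, lintegral_const_mul' _ _ ENNReal.ofReal_ne_top]
      _ ≤ u p.1 + u p.2 + ENNReal.ofReal κ * δ := by gcongr
      _ < ENNReal.ofReal (ε / 4) + ENNReal.ofReal (ε / 4) + ENNReal.ofReal (ε / 4) := by
          rw [hκδ]
          exact ENNReal.add_lt_add_right ENNReal.ofReal_ne_top (ENNReal.add_lt_add hu₁ hu₂)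
      _ ≤ ENNReal.ofReal ε := by
          rw [← ENNReal.ofReal_add hε4.le hε4.le, ← ENNReal.ofReal_add (by positivity) hε4.le]
          exact ENNReal.ofReal_le_ofReal (by linarith)

/-- A chain which generates the filtration is standard if and only if the criterion holds. -/
lemma IsMarkovRealization.isStandardChain_iff (h𝔉 : IsFiniteType 𝔉 μ) {k : ℕ → ℕ}
    {Φ : X → Path k} (hΦ : IsMarkovRealization 𝔉 μ Φ) :
    IsStandardChain 𝔉 μ Φ ↔ StandardnessCriterion 𝔉 μ := by
  refine ⟨fun ⟨_, ρ, hρ, hlim⟩ => ?_, fun h => h.isStandardChain h𝔉 hΦ.1.1⟩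
  refine standardnessCriterion_of_tendsto h𝔉 hΦ.1.1 (fun s hs => (hΦ.2 0).1 s ?_) hρ hlim
  rw [𝔉.alg_zero]
  exact hs

end StandardToCriterion

/-! ### Finite σ-algebras as σ-algebras of finite-valued maps. -/

section FiniteAlgebra

variable {X : Type*}

/-- A finitely generated σ-algebra is generated by a map to a finite set. -/
lemma exists_comap_fin_eq_generateFrom {S : Set (Set X)} (hS : S.Finite) :
    ∃ (k : ℕ) (φ : X → Fin k), MeasurableSpace.comap φ inferInstance =
      MeasurableSpace.generateFrom S := by
  classical
  have := hS.to_subtype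
  obtain ⟨k, ⟨e⟩⟩ := Finite.exists_equiv_fin (S → Prop)
  -- The state is the vector of memberships in all generators.
  let ι : X → S → Prop := fun x s => x ∈ (s : Set X)
  refine ⟨k, e ∘ ι, ?_⟩
  have he : MeasurableSpace.comap e inferInstance = (inferInstance : MeasurableSpace (S → Prop)) :=
    le_antisymm (measurable_of_finite e).comap_le fun s _ =>
      ⟨e.symm ⁻¹' s, MeasurableSet.of_discrete, by ext; simp⟩
  rw [← MeasurableSpace.comap_comp, he]
  change MeasurableSpace.comap ι MeasurableSpace.pi = _
  simp only [MeasurableSpace.pi, MeasurableSpace.comap_iSup, MeasurableSpace.comap_comp]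
  have : ∀ s : S, MeasurableSpace.comap ((fun b : S → Prop => b s) ∘ ι) ⊤ =
      MeasurableSpace.generateFrom {(s : Set X)} := fun s =>
    (MeasurableSpace.generateFrom_singleton (s : Set X)).symm
  refine (iSup_congr this).trans ?_
  refine le_antisymm (iSup_le fun s => MeasurableSpace.generateFrom_mono (by simp))
    (MeasurableSpace.generateFrom_le fun s hs => ?_)
  exact le_iSup (fun s : S => MeasurableSpace.generateFrom {(s : Set X)}) ⟨s, hs⟩ s
    (MeasurableSpace.measurableSet_generateFrom rfl)

lemma finite_measurableSet_generateFrom {S : Set (Set X)} (hS : S.Finite) :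
    {s | MeasurableSet[MeasurableSpace.generateFrom S] s}.Finite := by
  obtain ⟨k, φ, hφ⟩ := exists_comap_fin_eq_generateFrom hS
  rw [← hφ]
  refine (Set.finite_range (Set.preimage φ)).subset ?_
  rintro s ⟨t, -, rfl⟩
  exact ⟨t, rfl⟩

lemma finite_measurableSet_sup {m₁ m₂ : MeasurableSpace X}
    (h₁ : {s | MeasurableSet[m₁] s}.Finite) (h₂ : {s | MeasurableSet[m₂] s}.Finite) :
    {s | MeasurableSet[m₁ ⊔ m₂] s}.Finite := by
  rw [← @MeasurableSpace.generateFrom_measurableSet X m₁,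
    ← @MeasurableSpace.generateFrom_measurableSet X m₂,
    MeasurableSpace.generateFrom_sup_generateFrom]
  exact finite_measurableSet_generateFrom (h₁.union h₂)

end FiniteAlgebra

/-! ### Finitely many conditional probabilities and labels of sub-blocks. -/

section Separation

variable {X : Type*} [mX : MeasurableSpace X] [StandardBorelSpace X]
  {𝔉 : DecFiltration X} {μ : Measure X} [IsFiniteMeasure μ]

/-- Every conditional probability is a partial sum of one of the finitely many probability vectors,
so the set of all partial sums serves as V. -/
lemma IsFiniteType.exists_finset_condMeasure (h : IsFiniteType 𝔉 μ) (n : ℕ) :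
    ∃ V : Finset ℝ≥0∞, ∀ᵐ x ∂μ, ∀ s, condMeasure 𝔉 μ n x s ∈ V := by
  classical
  obtain ⟨P, hP, hx⟩ := h n
  refine ⟨hP.toFinset.biUnion fun p => p.powerset.toFinset.image Multiset.sum, ?_⟩
  filter_upwards [hx] with x ⟨C, _, h0, hC⟩ s
  simp only [Finset.mem_biUnion, Set.Finite.mem_toFinset, Finset.mem_image, Multiset.mem_toFinset,
    Multiset.mem_powerset]
  refine ⟨_, hC, (C.filter (· ∈ s)).val.map fun y => condMeasure 𝔉 μ n x {y},
    Multiset.map_le_map (Finset.val_le_iff.2 (Finset.filter_subset _ _)), ?_⟩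
  have h1 : condMeasure 𝔉 μ n x s = condMeasure 𝔉 μ n x (C.filter (· ∈ s) : Finset X) := by
    refine le_antisymm ?_ (measure_mono fun y hy => (Finset.mem_filter.1 hy).2)
    refine (measure_mono (t := ((C.filter (· ∈ s) : Finset X) : Set X) ∪ (C : Set X)ᶜ)
      fun y hy => ?_).trans ((measure_union_le _ _).trans (by rw [h0, add_zero]))
    by_cases hyC : y ∈ C
    · left; simpa using ⟨hyC, hy⟩
    · right; simpa using hyC
  rw [h1, ← sum_measure_singleton]
  rfl

variable (𝔉 μ) in
/-- The conditional distribution function of the code of the block of level `n`, given `𝔄_{n+1}`: it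
separates the blocks of level `n` which are contained in a common block of level `n + 1`. -/
def blockRank (n : ℕ) (x : X) : ℝ≥0∞ :=
  condMeasure 𝔉 μ (n + 1) x {y | condCode 𝔉 μ n y ≤ condCode 𝔉 μ n x}

lemma measurable_kernel_le {α β : Type*} [MeasurableSpace α] [MeasurableSpace β] (κ : Kernel α β)
    [IsSFiniteKernel κ] {g : β → ℝ} {h : α → ℝ} (hg : Measurable g) (hh : Measurable h) :
    Measurable fun a => κ a {b | g b ≤ h a} :=
  Kernel.measurable_kernel_prodMk_left
    (measurableSet_le (hg.comp measurable_snd) (hh.comp measurable_fst))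

/-- The conditional measure is 𝔄_{n+1}-measurable and the threshold is 𝔄_n-measurable, hence both
depend measurably on the 𝔄_n-information. -/
lemma measurable_blockRank (n : ℕ) : Measurable[𝔉.alg n] (blockRank 𝔉 μ n) := by
  have hle := 𝔉.antitone_alg n.le_succ
  exact @measurable_kernel_le X X (𝔉.alg n) mX
    (@Kernel.comap X X (𝔉.alg (n + 1)) mX X (𝔉.alg n) (condExpKernel μ (𝔉.alg (n + 1))) id
      (measurable_id'' hle)) inferInstance _ _
    ((measurable_condCode 𝔉 μ n).mono (𝔉.alg_le n) le_rfl) (measurable_condCode 𝔉 μ n)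

namespace IsRegularSet

variable {G : Set X} (hG : IsRegularSet 𝔉 μ G) {x y : X} {n : ℕ}
include hG

/-- A distribution function increases strictly at every charged value. The rank thus separates
sub-blocks as well as the code does, but almost surely takes values in a finite set. -/
lemma blockRank_eq_iff (hx : x ∈ G) (hy : y ∈ block 𝔉 μ (n + 1) x) :
    blockRank 𝔉 μ n y = blockRank 𝔉 μ n x ↔ y ∈ block 𝔉 μ n x := by
  have hyG := hG.block_subset x hx _ hy
  have hκ := hG.condMeasure_eq x hx _ y hy
  have hlt : ∀ a b : X, b ∈ block 𝔉 μ (n + 1) x → condCode 𝔉 μ n a < condCode 𝔉 μ n b →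
      condMeasure 𝔉 μ (n + 1) x {z | condCode 𝔉 μ n z ≤ condCode 𝔉 μ n a} <
        condMeasure 𝔉 μ (n + 1) x {z | condCode 𝔉 μ n z ≤ condCode 𝔉 μ n b} := by
    intro a b hb hab
    have hd : Disjoint {z | condCode 𝔉 μ n z ≤ condCode 𝔉 μ n a} {b} := by
      rw [Set.disjoint_singleton_right]
      exact not_le.2 hab
    refine (ENNReal.lt_add_right (measure_ne_top _ _) hb).trans_le ?_
    rw [← measure_union hd (measurableSet_singleton b)]
    refine measure_mono (Set.union_subset (fun z hz => le_trans hz hab.le) ?_)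
    rw [Set.singleton_subset_iff]
    exact le_refl (condCode 𝔉 μ n b)
  constructor
  · intro h
    rw [blockRank, blockRank, hκ] at h
    have hcode : condCode 𝔉 μ n y = condCode 𝔉 μ n x := by
      rcases lt_trichotomy (condCode 𝔉 μ n y) (condCode 𝔉 μ n x) with h1 | h1 | h1
      · exact absurd h (hlt y x (hG.mem_block x hx _) h1).ne
      · exact h1
      · exact absurd h (hlt x y hy h1).ne'
    have h2 := hG.mem_block y hyG n
    simp only [block, (condCode_eq_iff 𝔉 μ n y x).1 hcode] at h2
    exact h2
  · intro h
    rw [blockRank, blockRank, hκ, (condCode_eq_iff 𝔉 μ n y x).2 (hG.condMeasure_eq x hx n y h)]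

/-- The conditional measure on a block of level `n` is obtained by conditioning from the block of
level `n + 1` which contains it. -/
lemma condMeasure_inter_blockRank (hx : x ∈ G) {s : Set X} (hs : MeasurableSet s) {v : ℝ≥0∞}
    (hv : blockRank 𝔉 μ n x = v) :
    condMeasure 𝔉 μ (n + 1) x (s ∩ blockRank 𝔉 μ n ⁻¹' {v}) =
      condMeasure 𝔉 μ (n + 1) x (blockRank 𝔉 μ n ⁻¹' {v}) * condMeasure 𝔉 μ n x s := by
  have hw : MeasurableSet (blockRank 𝔉 μ n ⁻¹' {v}) :=
    𝔉.alg_le n _ (measurable_blockRank n (measurableSet_singleton v))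
  have hconst : ∀ z ∈ G, ∀ᵐ y ∂condMeasure 𝔉 μ n z, blockRank 𝔉 μ n y = blockRank 𝔉 μ n z := by
    intro z hz
    filter_upwards [show ∀ᵐ y ∂condMeasure 𝔉 μ n z, y ∈ block 𝔉 μ n z from hG.compl_block z hz n]
      with y hy
    exact (hG.blockRank_eq_iff hz (hG.block_subset_succ hz hy)).2 hy
  conv_lhs => rw [← hG.bind_eq x hx n,
    Measure.bind_apply (hs.inter hw) (measurable_condMeasure 𝔉 μ n).aemeasurable]
  rw [← lintegral_indicator_one hw, ← lintegral_mul_const _ (measurable_one.indicator hw)]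
  refine lintegral_congr_ae ?_
  filter_upwards [show ∀ᵐ z ∂condMeasure 𝔉 μ (n + 1) x, z ∈ block 𝔉 μ (n + 1) x from
    hG.compl_block x hx (n + 1)] with z hz
  have hzG := hG.block_subset x hx _ hz
  -- Averaging over the sub-blocks of level n: that of x contributes μ_n^x(s), and the others do not
  -- charge the rank v.
  by_cases hzv : blockRank 𝔉 μ n z = v
  · have hzx := (hG.blockRank_eq_iff hx hz).1 (hzv.trans hv.symm)
    rw [Set.indicator_of_mem (by exact hzv), Pi.one_apply, one_mul,
      hG.condMeasure_eq x hx n z hzx]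
    refine measure_congr ?_
    filter_upwards [hconst x hx] with y hy
    exact propext ⟨fun h => h.1, fun h => ⟨h, hy.trans hv⟩⟩
  · rw [Set.indicator_of_notMem (by exact hzv), zero_mul]
    refine measure_mono_null Set.inter_subset_right (measure_eq_zero_iff_ae_notMem.2 ?_)
    filter_upwards [hconst z hzG] with y hy
    exact fun h => hzv (hy.symm.trans h)

end IsRegularSet

end Separation

/-! ### Construction of a generating Markov chain. -/

section Realization

variable {X : Type*} [mX : MeasurableSpace X] [StandardBorelSpace X]
  (𝔉 : DecFiltration X) (μ : Measure X) [IsFiniteMeasure μ] (V : ℕ → Finset ℝ≥0∞)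

/-- The events of level `n` which record the rank of the block of level `n` and the conditional
probabilities of the members of a collection of sets. -/
def levelGenerators (n : ℕ) (𝓒 : Set (Set X)) : Set (Set X) :=
  (fun v => blockRank 𝔉 μ n ⁻¹' {v}) '' (V (n + 1) : Set ℝ≥0∞) ∪
    Set.image2 (fun s v => {x | condMeasure 𝔉 μ n x s = v}) 𝓒 (V n : Set ℝ≥0∞)

/-- The events that are recorded by the states of the levels below `n`, together with the first `n`
generating sets. -/
@[reducible] def histAlg : ℕ → MeasurableSpace X
  | 0 => ⊥
  | n + 1 => (histAlg n ⊔ MeasurableSpace.generateFrom {genSet X n}) ⊔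
      MeasurableSpace.generateFrom (levelGenerators 𝔉 μ V n {s | MeasurableSet[histAlg n] s})

/-- The σ-algebra of the state of level `n`. -/
@[reducible] def stateAlg (n : ℕ) : MeasurableSpace X :=
  MeasurableSpace.generateFrom (levelGenerators 𝔉 μ V n {s | MeasurableSet[histAlg 𝔉 μ V n] s})

/-- The σ-algebra of the states of the levels from `n` on. -/
@[reducible] def futureAlg (n : ℕ) : MeasurableSpace X := ⨆ m ≥ n, stateAlg 𝔉 μ V m

lemma finite_levelGenerators (n : ℕ) {𝓒 : Set (Set X)} (h : 𝓒.Finite) :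
    (levelGenerators 𝔉 μ V n 𝓒).Finite :=
  ((V (n + 1)).finite_toSet.image _).union (h.image2 _ (V n).finite_toSet)

lemma finite_histAlg (n : ℕ) : {s | MeasurableSet[histAlg 𝔉 μ V n] s}.Finite := by
  induction n with
  | zero =>
    refine (Set.toFinite {∅, Set.univ}).subset fun s hs => ?_
    exact MeasurableSpace.measurableSet_bot_iff.1 hs
  | succ n ih =>
    exact finite_measurableSet_sup (finite_measurableSet_sup ih
      (finite_measurableSet_generateFrom (Set.finite_singleton _)))
      (finite_measurableSet_generateFrom (finite_levelGenerators 𝔉 μ V n ih))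

lemma generateFrom_levelGenerators_le (n : ℕ) {𝓒 : Set (Set X)} (h : ∀ s ∈ 𝓒, MeasurableSet s) :
    MeasurableSpace.generateFrom (levelGenerators 𝔉 μ V n 𝓒) ≤ 𝔉.alg n := by
  refine MeasurableSpace.generateFrom_le ?_
  rintro _ (⟨v, -, rfl⟩ | ⟨s, hs, v, -, rfl⟩)
  · exact measurable_blockRank n (measurableSet_singleton v)
  · exact measurable_condMeasure_apply 𝔉 μ n (h s hs) (measurableSet_singleton v)

lemma histAlg_le (n : ℕ) : histAlg 𝔉 μ V n ≤ mX := by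
  induction n with
  | zero => exact bot_le
  | succ n ih =>
    refine sup_le (sup_le ih (MeasurableSpace.generateFrom_le ?_))
      ((generateFrom_levelGenerators_le 𝔉 μ V n ih).trans (𝔉.alg_le n))
    rintro _ rfl
    exact measurableSet_genSet n

lemma stateAlg_le (n : ℕ) : stateAlg 𝔉 μ V n ≤ 𝔉.alg n :=
  generateFrom_levelGenerators_le 𝔉 μ V n (histAlg_le 𝔉 μ V n)

lemma futureAlg_le (n : ℕ) : futureAlg 𝔉 μ V n ≤ 𝔉.alg n :=
  iSup₂_le fun m hm => (stateAlg_le 𝔉 μ V m).trans (𝔉.antitone_alg hm)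

lemma monotone_histAlg : Monotone (histAlg 𝔉 μ V) :=
  monotone_nat_of_le_succ fun _ => le_sup_left.trans le_sup_left

lemma stateAlg_le_histAlg {n p : ℕ} (h : n < p) : stateAlg 𝔉 μ V n ≤ histAlg 𝔉 μ V p :=
  (le_sup_right : stateAlg 𝔉 μ V n ≤ histAlg 𝔉 μ V (n + 1)).trans (monotone_histAlg 𝔉 μ V h)

lemma measurableSet_histAlg_genSet (j : ℕ) :
    MeasurableSet[histAlg 𝔉 μ V (j + 1)] (genSet X j) :=
  (le_sup_right.trans le_sup_left : MeasurableSpace.generateFrom {genSet X j} ≤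
    histAlg 𝔉 μ V (j + 1)) _ (MeasurableSpace.measurableSet_generateFrom rfl)

lemma stateAlg_le_futureAlg {n m : ℕ} (h : n ≤ m) : stateAlg 𝔉 μ V m ≤ futureAlg 𝔉 μ V n :=
  le_iSup₂_of_le m h le_rfl

lemma futureAlg_antitone : Antitone (futureAlg 𝔉 μ V) := fun _ _ h =>
  iSup₂_le fun _ hm => stateAlg_le_futureAlg 𝔉 μ V (h.trans hm)

lemma measurableSet_stateAlg_blockRank {n : ℕ} {v : ℝ≥0∞} (hv : v ∈ V (n + 1)) :
    MeasurableSet[stateAlg 𝔉 μ V n] (blockRank 𝔉 μ n ⁻¹' {v}) :=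
  MeasurableSpace.measurableSet_generateFrom (Or.inl ⟨v, hv, rfl⟩)

variable {V} (hV : ∀ n, ∀ᵐ x ∂μ, ∀ s, condMeasure 𝔉 μ n x s ∈ V n)
include hV

/-- The conditional probability has almost surely finitely many values, and the events where they
are taken are among the generators of the state. This is the source of the Markov property. -/
lemma exists_measurable_stateAlg_ae_eq (n : ℕ) {s : Set X}
    (hs : MeasurableSet[histAlg 𝔉 μ V n] s) :
    ∃ g : X → ℝ≥0∞, Measurable[stateAlg 𝔉 μ V n] g ∧
      (fun x => condMeasure 𝔉 μ n x s) =ᵐ[μ] g := by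
  classical
  refine ⟨fun x => ∑ v ∈ V n, {x | condMeasure 𝔉 μ n x s = v}.indicator (fun _ => v) x, ?_, ?_⟩
  · refine @Finset.measurable_fun_sum _ _ _ _ _ _ (stateAlg 𝔉 μ V n) _ _ fun v hv => ?_
    refine Measurable.indicator (@measurable_const ℝ≥0∞ X _ (stateAlg 𝔉 μ V n) v) ?_
    exact MeasurableSpace.measurableSet_generateFrom (Or.inr ⟨s, hs, v, hv, rfl⟩)
  · filter_upwards [hV n] with x hx
    rw [Finset.sum_eq_single_of_mem _ (hx s) fun v _ hv => Set.indicator_of_notMem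
      (s := {x | condMeasure 𝔉 μ n x s = v}) (Ne.symm hv) _]
    rw [Set.indicator_of_mem]
    rfl

/-- Induction on p - n. For p ≤ n the state of level n records the probability itself. For n < p,
Bayes' formula expresses it as a quotient of conditional probabilities given 𝔄_{n+1} on the rank
class W of x; both s ∩ W and W still belong to the history of level p. -/
lemma exists_measurable_futureAlg_ae_eq_of_histAlg (h𝔉 : IsFiniteType 𝔉 μ) (p n : ℕ) {s : Set X}
    (hs : MeasurableSet[histAlg 𝔉 μ V p] s) :
    ∃ g : X → ℝ≥0∞, Measurable[futureAlg 𝔉 μ V n] g ∧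
      (fun x => condMeasure 𝔉 μ n x s) =ᵐ[μ] g := by
  classical
  by_cases hpn : p ≤ n
  · obtain ⟨g, hg, hgs⟩ := exists_measurable_stateAlg_ae_eq 𝔉 μ hV n
      (monotone_histAlg 𝔉 μ V hpn s hs)
    exact ⟨g, hg.mono (stateAlg_le_futureAlg 𝔉 μ V le_rfl) le_rfl, hgs⟩
  · have hnp : n < p := not_le.1 hpn
    have hw : ∀ v ∈ V (n + 1), MeasurableSet[histAlg 𝔉 μ V p] (blockRank 𝔉 μ n ⁻¹' {v}) :=
      fun v hv => stateAlg_le_histAlg 𝔉 μ V hnp _ (measurableSet_stateAlg_blockRank 𝔉 μ V hv)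
    have hex : ∀ v, ∃ g₁ g₂ : X → ℝ≥0∞, v ∈ V (n + 1) →
        Measurable[futureAlg 𝔉 μ V (n + 1)] g₁ ∧ Measurable[futureAlg 𝔉 μ V (n + 1)] g₂ ∧
        (fun x => condMeasure 𝔉 μ (n + 1) x (s ∩ blockRank 𝔉 μ n ⁻¹' {v})) =ᵐ[μ] g₁ ∧
        (fun x => condMeasure 𝔉 μ (n + 1) x (blockRank 𝔉 μ n ⁻¹' {v})) =ᵐ[μ] g₂ := by
      intro v
      by_cases hv : v ∈ V (n + 1)
      · obtain ⟨g₁, h1, h1'⟩ := exists_measurable_futureAlg_ae_eq_of_histAlg h𝔉 p (n + 1)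
          (MeasurableSet.inter hs (hw v hv))
        obtain ⟨g₂, h2, h2'⟩ := exists_measurable_futureAlg_ae_eq_of_histAlg h𝔉 p (n + 1) (hw v hv)
        exact ⟨g₁, g₂, fun _ => ⟨h1, h2, h1', h2'⟩⟩
      · exact ⟨0, 0, fun h => absurd h hv⟩
    choose g₁ g₂ hg using hex
    have hle := futureAlg_antitone 𝔉 μ V n.le_succ
    refine ⟨fun x => ∑ v ∈ V (n + 1), (blockRank 𝔉 μ n ⁻¹' {v}).indicator
      (g₁ v / g₂ v) x, ?_, ?_⟩
    · refine @Finset.measurable_fun_sum _ _ _ _ _ _ (futureAlg 𝔉 μ V n) _ _ fun v hv => ?_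
      refine Measurable.indicator (Measurable.div
        ((hg v hv).1.mono hle le_rfl) ((hg v hv).2.1.mono hle le_rfl)) ?_
      exact stateAlg_le_futureAlg 𝔉 μ V le_rfl _ (measurableSet_stateAlg_blockRank 𝔉 μ V hv)
    · obtain ⟨G, hG, hGae, hGp⟩ := h𝔉.exists_isRegularSet (hV (n + 1))
      have hall : ∀ᵐ x ∂μ, ∀ v ∈ V (n + 1),
          condMeasure 𝔉 μ (n + 1) x (s ∩ blockRank 𝔉 μ n ⁻¹' {v}) = g₁ v x ∧
          condMeasure 𝔉 μ (n + 1) x (blockRank 𝔉 μ n ⁻¹' {v}) = g₂ v x := by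
        refine (Finset.eventually_all _).2 fun v hv => ?_
        filter_upwards [(hg v hv).2.2.1, (hg v hv).2.2.2] with x h1 h2 using ⟨h1, h2⟩
      filter_upwards [hGae, hall] with x hx hxg
      have hmem : blockRank 𝔉 μ n x ∈ V (n + 1) := hGp x hx _
      rw [Finset.sum_eq_single_of_mem _ hmem fun v _ hv => Set.indicator_of_notMem
        (s := blockRank 𝔉 μ n ⁻¹' {v}) (fun h => hv (Set.mem_singleton_iff.1 h).symm) _,
        Set.indicator_of_mem (by rfl), Pi.div_apply,
        ← (hxg _ hmem).1, ← (hxg _ hmem).2,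
        hG.condMeasure_inter_blockRank hx (histAlg_le 𝔉 μ V p s hs) rfl, mul_comm,
        ENNReal.mul_div_cancel_right ?_ (measure_ne_top _ _)]
      -- The denominator is positive because x is an atom in its own rank class.
      exact fun h0 => hG.mem_block x hx (n + 1)
        (measure_mono_null (t := blockRank 𝔉 μ n ⁻¹' {blockRank 𝔉 μ n x})
          (Set.singleton_subset_iff.2 rfl) h0)
  termination_by p - n

/-- The j-th generating set enters the history at level j + 1; a Dynkin class argument extends the
claim to all measurable sets. -/
lemma exists_measurable_futureAlg_ae_eq (h𝔉 : IsFiniteType 𝔉 μ) (n : ℕ) {s : Set X}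
    (hs : MeasurableSet s) :
    ∃ g : X → ℝ≥0∞, Measurable[futureAlg 𝔉 μ V n] g ∧
      (fun x => condMeasure 𝔉 μ n x s) =ᵐ[μ] g := by
  induction s, hs using MeasurableSpace.induction_on_inter (generateFrom_range_genSet (X := X))
    isPiSystem_range_genSet with
  | empty => exact ⟨0, @measurable_const _ _ _ (futureAlg 𝔉 μ V n) 0, by simp; rfl⟩
  | basic t ht =>
    obtain ⟨j, rfl⟩ := ht
    exact exists_measurable_futureAlg_ae_eq_of_histAlg 𝔉 μ hV h𝔉 (j + 1) n
      (measurableSet_histAlg_genSet 𝔉 μ V j)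
  | compl t ht ih =>
    obtain ⟨g, hg, hgt⟩ := ih
    refine ⟨fun x => 1 - g x, hg.const_sub 1, ?_⟩
    filter_upwards [hgt] with x hx
    rw [prob_compl_eq_one_sub ht, hx]
  | iUnion f hd hm ih =>
    choose g hg hgf using ih
    refine ⟨fun x => ∑' i, g i x, @Measurable.tsum X _ _ (futureAlg 𝔉 μ V n) _ _ _ _ _ _ _ _ _ _ _ _ hg, ?_⟩
    filter_upwards [ae_all_iff.2 hgf] with x hx
    rw [measure_iUnion hd hm]
    exact tsum_congr hx

/-- An 𝔄_n-measurable set is almost surely the event that its own conditional probability given 𝔄_n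
equals 1. -/
lemma exists_measurableSet_futureAlg_ae_eq (h𝔉 : IsFiniteType 𝔉 μ) (n : ℕ) {s : Set X}
    (hs : MeasurableSet[𝔉.alg n] s) :
    ∃ t, MeasurableSet[futureAlg 𝔉 μ V n] t ∧ s =ᵐ[μ] t := by
  classical
  obtain ⟨g, hg, hgs⟩ := exists_measurable_futureAlg_ae_eq 𝔉 μ hV h𝔉 n (𝔉.alg_le n s hs)
  refine ⟨g ⁻¹' {1}, hg (measurableSet_singleton 1), ?_⟩
  filter_upwards [hgs, ae_condMeasure_apply_of_measurableSet 𝔉 μ n hs] with x h1 h2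
  refine propext (?_ : x ∈ s ↔ g x = 1)
  rw [← h1, h2, Set.indicator_apply]
  by_cases hx : x ∈ s <;> simp [hx]

/-- A process whose transition probabilities backwards in time depend on the state only is a Markov
chain. -/
lemma isMarkovChain_of_comap_eq {k : ℕ → ℕ} {φ : ∀ n, X → Fin (k n)}
    (hφ : ∀ n, MeasurableSpace.comap (φ n) inferInstance = stateAlg 𝔉 μ V n) :
    IsMarkovChain μ (fun x n => φ n x) := by
  have hφm : ∀ n, Measurable[𝔉.alg n] (φ n) := fun n =>
    Measurable.mono (comap_measurable (φ n)) ((hφ n).le.trans (stateAlg_le 𝔉 μ V n)) le_rfl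
  have hE : ∀ n b, MeasurableSet[𝔉.alg n] (φ n ⁻¹' {b}) := fun n b =>
    hφm n (measurableSet_singleton b)
  refine ⟨measurable_pi_lambda _ fun n => (hφm n).mono (𝔉.alg_le n) le_rfl, fun n a => ?_⟩
  -- Given the state of level n, the strict past is independent of 𝔄_n; Q is its conditional
  -- probability. The bound i < n is strict since B already fixes the coordinate n.
  have key : ∀ n, ∃ Q : ℝ≥0∞, ∀ B, MeasurableSet[𝔉.alg n] B → B ⊆ φ n ⁻¹' {a n} →
      μ ({x | ∀ i < n, φ i x = a i} ∩ B) = Q * μ B := by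
    intro n
    induction n with
    | zero => exact ⟨1, fun B _ _ => by simp⟩
    | succ n ih =>
      obtain ⟨Q, hQ⟩ := ih
      have hEm : MeasurableSet[histAlg 𝔉 μ V (n + 1)] (φ n ⁻¹' {a n}) := by
        refine stateAlg_le_histAlg 𝔉 μ V n.lt_succ_self _ ?_
        rw [← hφ n]
        exact ⟨{a n}, measurableSet_singleton _, rfl⟩
      obtain ⟨g, hg, hgE⟩ := exists_measurable_stateAlg_ae_eq 𝔉 μ hV (n + 1) hEm
      rw [← hφ (n + 1)] at hg
      obtain ⟨q, -, hq⟩ := hg.exists_eq_measurable_comp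
      -- q is the backward transition probability: the probability given 𝔄_{n+1} that coordinate n
      -- is `a n`, as a function of the state of level n + 1.
      refine ⟨Q * q (a (n + 1)), fun B hB hBs => ?_⟩
      have hBm := 𝔉.alg_le _ _ hB
      have hset : {x | ∀ i < n + 1, φ i x = a i} ∩ B =
          {x | ∀ i < n, φ i x = a i} ∩ (B ∩ φ n ⁻¹' {a n}) := by
        ext x
        simp only [Set.mem_inter_iff, Set.mem_ofPred_eq, Set.mem_preimage, Set.mem_singleton_iff,
          Nat.lt_succ_iff_lt_or_eq]
        constructor
        · rintro ⟨h1, h2⟩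
          exact ⟨fun i hi => h1 i (Or.inl hi), h2, h1 n (Or.inr rfl)⟩
        · rintro ⟨h1, h2, h3⟩
          refine ⟨fun i hi => ?_, h2⟩
          rcases hi with hi | rfl
          · exact h1 i hi
          · exact h3
      rw [hset, hQ _ (MeasurableSet.inter (𝔉.antitone_alg n.le_succ _ hB) (hE n _))
        Set.inter_subset_right, mul_assoc,
        ← setLIntegral_condMeasure 𝔉 μ (n + 1) hB (𝔉.alg_le n _ (hE n _)), ← setLIntegral_const]
      congr 1
      refine setLIntegral_congr_fun_ae hBm ?_
      filter_upwards [hgE] with x hx hxB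
      have : φ (n + 1) x = a (n + 1) := hBs hxB
      rw [hx, hq, Function.comp_apply, this]
  obtain ⟨Q, hQ⟩ := key n
  have h1 := hQ (φ n ⁻¹' {a n}) (hE n _) subset_rfl
  have h2 := hQ (φ n ⁻¹' {a n} ∩ φ (n + 1) ⁻¹' {a (n + 1)})
    (MeasurableSet.inter (hE n _) (𝔉.antitone_alg n.le_succ _ (hE (n + 1) _)))
    Set.inter_subset_left
  have s1 : {x | ∀ i ≤ n, φ i x = a i} = {x | ∀ i < n, φ i x = a i} ∩ φ n ⁻¹' {a n} := by
    ext x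
    simp only [Set.mem_inter_iff, Set.mem_ofPred_eq, Set.mem_preimage, Set.mem_singleton_iff]
    constructor
    · exact fun h => ⟨fun i hi => h i hi.le, h n le_rfl⟩
    · rintro ⟨h1, h2⟩ i hi
      rcases hi.lt_or_eq with hi | rfl
      · exact h1 i hi
      · exact h2
  have s2 : {x | ∀ i ≤ n + 1, φ i x = a i} = {x | ∀ i < n, φ i x = a i} ∩
      (φ n ⁻¹' {a n} ∩ φ (n + 1) ⁻¹' {a (n + 1)}) := by
    rw [← Set.inter_assoc, ← s1]
    ext x
    simp only [Set.mem_inter_iff, Set.mem_ofPred_eq, Set.mem_preimage, Set.mem_singleton_iff]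
    constructor
    · exact fun h => ⟨fun i hi => h i (hi.trans n.le_succ), h _ le_rfl⟩
    · rintro ⟨h1, h2⟩ i hi
      rcases hi.lt_or_eq with hi | rfl
      · exact h1 i (Nat.lt_succ_iff.1 hi)
      · exact h2
  rw [s1, s2, h1, h2]
  exact (mul_right_comm _ _ _)

omit hV

variable {𝔉 μ}

/-- Every filtration of finite type is generated by a Markov chain with finite state sets. -/
lemma IsFiniteType.exists_isMarkovRealization (h𝔉 : IsFiniteType 𝔉 μ) :
    ∃ (k : ℕ → ℕ) (Φ : X → Path k), IsMarkovRealization 𝔉 μ Φ := by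
  choose V hV using h𝔉.exists_finset_condMeasure
  choose k φ hφ using fun n => exists_comap_fin_eq_generateFrom
    (finite_levelGenerators 𝔉 μ V n (finite_histAlg 𝔉 μ V n))
  have htail : ∀ n, tailAlg (fun x n => φ n x) n = futureAlg 𝔉 μ V n := fun n =>
    iSup_congr fun m => iSup_congr fun _ => hφ m
  refine ⟨k, fun x n => φ n x, isMarkovChain_of_comap_eq 𝔉 μ hV hφ, fun n => ⟨fun s hs => ?_,
    fun t ht => ⟨t, futureAlg_le 𝔉 μ V n t (htail n ▸ ht), Filter.EventuallyEq.rfl⟩⟩⟩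
  rw [htail n]
  exact exists_measurableSet_futureAlg_ae_eq 𝔉 μ hV h𝔉 n hs

end Realization

end MarkovFiltration

end

theorem mainTheorem1 {X : Type*} [MeasurableSpace X] [StandardBorelSpace X]
    (μ : MeasureTheory.Measure X) [MeasureTheory.IsProbabilityMeasure μ]
    (𝔉 : MarkovFiltration.DecFiltration X) (h𝔉 : MarkovFiltration.IsFiniteType 𝔉 μ) :
    (MarkovFiltration.IsStandard 𝔉 μ ↔ MarkovFiltration.StandardnessCriterion 𝔉 μ) ∧
    (∀ (k : ℕ → ℕ) (Φ : X → MarkovFiltration.Path k), MarkovFiltration.IsMarkovRealization 𝔉 μ Φ →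
      (MarkovFiltration.IsStandardChain 𝔉 μ Φ ↔ MarkovFiltration.StandardnessCriterion 𝔉 μ)) := by
  refine ⟨⟨?_, fun h => ?_⟩, fun k Φ hΦ => hΦ.isStandardChain_iff h𝔉⟩
  · rintro ⟨k, Φ, hΦ, hs⟩
    exact (hΦ.isStandardChain_iff h𝔉).1 hs
  · obtain ⟨k, Φ, hΦ⟩ := h𝔉.exists_isMarkovRealization
    exact ⟨k, Φ, hΦ, (hΦ.isStandardChain_iff h𝔉).2 h⟩
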